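/- Let $K=L^2(0,\infty;dt)$ be the space of complex-valued square-integrable functions on $(0,\infty)$ and let $\mathcal F_+$ be the cosine transform on $K$, the unitary operator given by $\mathcal F_+(f)(u)=2\int_0^\infty\cos(2\pi tu)f(t)\,dt$ (in the $L^2$ sense). For $a>0$ let $K_a$ be the set of $f\in K$ such that both $f$ and $\mathcal F_+(f)$ vanish almost everywhere on $(0,a)$. A Sonine function is an element of $\bigcup_{a>0}K_a$. For a Sonine function $f$, the function $\pi^{-s/2}\Gamma(\tfrac s2)\int_0^\infty f(t)t^{-s}\,dt$, defined for $\operatorname{Re}(s)>\tfrac12$, extends to an entire function $M(f)$; for $f\neq0$ let $\mathcal Z_f$ be the multiset of zeros of $M(f)$ in $\mathbb C$, counted with multiplicity. If $f$ and $g$ are two non-zero Sonine functions with $\mathcal Z_f=\mathcal Z_g$, then $f$ and $g$ are multiplicative translates of one another up to a non-zero constant: there exist a complex number $c\neq0$ and a real number $r>0$ such that $f(t)=c\,g(rt)$ for almost every $t\in(0,\infty)$. -/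

import Mathlib

open MeasureTheory Set
open scoped FourierTransform ENNReal

noncomputable section

namespace Sonine

/-- The Hilbert space `K = L²(0, ∞; dt)` of complex-valued functions. -/
abbrev HalfLineL2 : Type := Lp ℂ 2 (volume.restrict (Ioi (0 : ℝ)))

theorem map_abs_le :
    Measure.map (fun x : ℝ => |x|) volume ≤ (2 : ℝ≥0∞) • volume.restrict (Ioi (0 : ℝ)) := by
  refine Measure.le_iff.2 fun s hs => ?_
  rw [Measure.map_apply (by fun_prop) hs, Measure.smul_apply, Measure.restrict_apply hs,
    smul_eq_mul, two_mul]
  have hsub : (fun x : ℝ => |x|) ⁻¹' s ⊆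
      (s ∩ Ioi 0) ∪ ((fun x : ℝ => -x) ⁻¹' (s ∩ Ioi 0) ∪ {0}) := by
    intro x hx
    rcases lt_trichotomy x 0 with h | h | h
    · right; left
      exact ⟨by simpa [abs_of_neg h] using hx, by simpa using h⟩
    · right; right
      exact h
    · left
      exact ⟨by simpa [abs_of_pos h] using hx, h⟩
  have hneg : volume ((fun x : ℝ => -x) ⁻¹' (s ∩ Ioi 0)) = volume (s ∩ Ioi (0 : ℝ)) :=
    (Measure.measurePreserving_neg (volume : Measure ℝ)).measure_preimage
      (hs.inter measurableSet_Ioi).nullMeasurableSet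
  calc volume ((fun x : ℝ => |x|) ⁻¹' s)
      ≤ volume ((s ∩ Ioi 0) ∪ ((fun x : ℝ => -x) ⁻¹' (s ∩ Ioi 0) ∪ {0})) := measure_mono hsub
    _ ≤ volume (s ∩ Ioi (0 : ℝ)) +
          (volume ((fun x : ℝ => -x) ⁻¹' (s ∩ Ioi 0)) + volume ({0} : Set ℝ)) :=
        (measure_union_le _ _).trans (by gcongr; exact measure_union_le _ _)
    _ = volume (s ∩ Ioi (0 : ℝ)) + volume (s ∩ Ioi (0 : ℝ)) := by
        rw [hneg, Real.volume_singleton, add_zero]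

theorem memLp_comp_abs (f : HalfLineL2) : MemLp (fun x : ℝ => f |x|) 2 volume := by
  have h : MemLp f 2 (Measure.map (fun x : ℝ => |x|) volume) :=
    ((Lp.memLp f).smul_measure (by simp)).mono_measure map_abs_le
  exact h.comp_of_map (by fun_prop)

/-- The extension of `f` to an even square-integrable function on `ℝ`. -/
def evenExt (f : HalfLineL2) : Lp ℂ 2 (volume : Measure ℝ) :=
  (memLp_comp_abs f).toLp (fun x : ℝ => f |x|)

/-- The cosine transform `f ↦ 2 ∫₀^∞ cos (2 π t u) f(t) dt` on `L²(0, ∞)`: the `L²` Fourier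
transform of the even extension, restricted to `(0, ∞)`. -/
def cosTransform (f : HalfLineL2) : HalfLineL2 :=
  ((Lp.memLp (𝓕 (evenExt f))).restrict (Ioi 0)).toLp _

/-- The Sonine space `K_a`: the elements of `L²(0, ∞)` which vanish (almost everywhere) on `(0, a)`
together with their cosine transform. -/
def sonineSpace (a : ℝ) : Set HalfLineL2 :=
  {f | (∀ᵐ t ∂(volume.restrict (Ioo 0 a)), f t = 0) ∧
    ∀ᵐ u ∂(volume.restrict (Ioo 0 a)), cosTransform f u = 0}

/-- A Sonine function is an element of the union of the spaces `K_a`, `a > 0`. -/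
def IsSonine (f : HalfLineL2) : Prop := ∃ a : ℝ, 0 < a ∧ f ∈ sonineSpace a

/-- The right Mellin transform `∫₀^∞ f(t) t^{-s} dt`. -/
def rightMellin (f : HalfLineL2) (s : ℂ) : ℂ := ∫ t in Ioi (0 : ℝ), f t * (t : ℂ) ^ (-s)

/-- `E` is an entire continuation of `π^{-s/2} Γ(s/2) ∫₀^∞ f(t) t^{-s} dt`. For a square-integrable
`f` vanishing near `0` this integral converges absolutely in the half-plane `Re s > 1/2`. -/
def IsEntireContinuation (f : HalfLineL2) (E : ℂ → ℂ) : Prop :=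
  Differentiable ℂ E ∧
    ∀ s : ℂ, 1 / 2 < s.re →
      E s = (Real.pi : ℂ) ^ (-s / 2) * Complex.Gamma (s / 2) * rightMellin f s

/-- There is at most one entire continuation. -/
theorem IsEntireContinuation.unique {f : HalfLineL2} {E E' : ℂ → ℂ}
    (h : IsEntireContinuation f E) (h' : IsEntireContinuation f E') : E = E' := by
  refine AnalyticOnNhd.eq_of_eventuallyEq (𝕜 := ℂ) (z₀ := 1)
    (fun z _ => h.1.analyticAt z) (fun z _ => h'.1.analyticAt z) ?_
  have ho : IsOpen {s : ℂ | 1 / 2 < s.re} := isOpen_lt continuous_const Complex.continuous_re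
  filter_upwards [ho.mem_nhds (by norm_num : (1 : ℂ) ∈ {s : ℂ | 1 / 2 < s.re})] with s hs
  rw [h.2 s hs, h'.2 s hs]

open Classical in
/-- The completed right Mellin transform, as a function on all of `ℂ`: the entire continuation of
`π^{-s/2} Γ(s/2) ∫₀^∞ f(t) t^{-s} dt` (with value `0` if `f` has none). -/
def completedMellin (f : HalfLineL2) : ℂ → ℂ :=
  if h : ∃ E : ℂ → ℂ, IsEntireContinuation f E then h.choose else 0

/-- The multiset of non-trivial zeros of `f`, as the function that sends `w` to its multiplicity:
the order of vanishing at `w` of the completed right Mellin transform. -/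
def zeroMultiset (f : HalfLineL2) : ℂ → ℕ∞ := fun w => analyticOrderAt (completedMellin f) w

end Sonine

end

/-! Write `M(f)` as the Mellin transform at `s/2` of `theta f`, the pairing of `f` with Gaussians.
Vanishing of `f` near `0` makes `theta f` decay exponentially at infinity. Gaussians are preserved
by the Fourier transform up to scaling, so vanishing of the cosine transform gives the same decay at
`0` (`theta_cosTransform`, `IsSonine.exists_norm_theta_le`). Hence `M(f)` is entire, with growth at
most `exp (A (1 + |s|) ^ (3/2))`.

If `M(f)` and `M(g)` have the same zeros, their quotient is `exp p` with `p` entire. Jensen's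
formula bounds the circle averages of `|Re p|` by `O(R ^ (3/2))`, so `p'' = 0` and `p = α s + β`
(`exists_eq_exp_mul`). The Gamma factors cancel, leaving `f̂(s) = exp (α s + β) ĝ(s)` for the right
Mellin transforms.

The exponent `α` is real. Both `f̂` and `ĝ` are at most exponential in `Re s` on `Re s ≥ 1`. If `Im
α ≠ 0`, the relation lets a suitable exponential multiple of `f̂` decay exponentially in `|Im s|`
there, and Phragmén–Lindelöf (`eq_zero_of_exp_decay`) then forces `f = 0`. For real `α` the factor
is the effect of a dilation, and Mellin injectivity concludes. -/

namespace Sonine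

/-! ### Phragmén–Lindelöf: exponential decay in a half-plane -/

open Complex in
/-- One step of the bootstrap: exponential decay away from the real axis together with decay of
rate `A` in the real direction improves the latter rate by `c`. -/
theorem norm_le_exp_step {G : ℂ → ℂ} {C c A : ℝ} (hc : 0 < c) (hA : 0 ≤ A)
    (hG : DiffContOnCl ℂ G {z | 0 < z.re})
    (hb : ∀ z : ℂ, 0 ≤ z.re → ‖G z‖ ≤ C * Real.exp (-A * z.re - c * |z.im|)) (z : ℂ)
    (hz : 0 ≤ z.re) :
    ‖G z‖ ≤ C * Real.exp (-(A + c) * z.re - c * |z.im|) := by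
  have hC : 0 ≤ C := by
    have := (norm_nonneg _).trans (hb 0 le_rfl)
    simpa using this
  have hbC : ∀ z : ℂ, 0 ≤ z.re → ‖G z‖ ≤ C := fun z hz => (hb z hz).trans <| by
    refine mul_le_of_le_one_right hC (Real.exp_le_one_iff.2 ?_)
    have h1 := mul_nonneg hA hz
    have h2 := mul_nonneg hc.le (abs_nonneg z.im)
    linarith
  -- Order of growth `1` is below the critical order `2` of a quadrant.
  have growth : ∀ (u : ℂ) (m : ℂ → ℂ) (S : Set ℂ), (∀ z ∈ S, 0 ≤ (m z).re) →
      (fun z => G (m z) * exp (u * z)) =O[Bornology.cobounded ℂ ⊓ Filter.principal S]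
        fun z => Real.exp (‖u‖ * ‖z‖ ^ (1 : ℝ)) := by
    intro u m S hm
    refine Asymptotics.IsBigO.of_bound C ?_
    filter_upwards [Filter.mem_inf_of_right (Filter.mem_principal_self S)] with z hz
    rw [norm_mul, norm_exp, Real.norm_of_nonneg (Real.exp_nonneg _), Real.rpow_one]
    refine mul_le_mul (hbC _ (hm z hz)) (Real.exp_le_exp.2 ?_) (Real.exp_nonneg _) hC
    exact (re_le_norm _).trans (norm_mul _ _).le
  -- Rotation by `1 - I` carries the first quadrant to the sector `|arg z| < π/4`. On its edges `Re
  -- z = |Im z|`, so the two decay rates add up to `A + c`; Phragmén–Lindelöf carries this to the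
  -- positive axis.
  have hray : ∀ x : ℝ, 0 ≤ x → ‖G x‖ ≤ C * Real.exp (-(A + c) * x) := by
    intro x hx
    have hmaps : MapsTo (fun z : ℂ => (1 - I) * z) (Ioi 0 ×ℂ Ioi 0) {z | 0 < z.re} := by
      intro z hz
      obtain ⟨h1, h2⟩ := mem_reProdIm.1 hz
      simp at h1 h2 ⊢
      linarith
    have key := PhragmenLindelof.quadrant_I (C := C)
      (f := fun z => G ((1 - I) * z) * exp (((A + c : ℝ) * (1 - I)) * z)) (z := x / 2 * (1 + I))
      ?_ ⟨1, by norm_num, _, growth _ _ _ fun z hz => (hmaps hz).le⟩ ?_ ?_ ?_ ?_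
    · have e : (1 - I) * (x / 2 * (1 + I)) = (x : ℂ) := by
        linear_combination (-x / 2 : ℂ) * I_sq
      simp only [mul_assoc, e] at key
      rw [norm_mul, norm_exp, ← ofReal_mul, ofReal_re] at key
      rw [show -(A + c) * x = -((A + c) * x) by ring, Real.exp_neg, ← div_eq_mul_inv,
        le_div_iff₀ (Real.exp_pos _)]
      exact key
    · exact (hG.comp (Differentiable.diffContOnCl (by fun_prop)) hmaps).smul
        (Differentiable.diffContOnCl (by fun_prop))
    · intro y hy
      rw [norm_mul, norm_exp]
      have := hb ((1 - I) * y) (by simpa using hy)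
      simp [abs_of_nonneg hy] at this ⊢
      calc _ ≤ _ := mul_le_mul_of_nonneg_right this (Real.exp_nonneg _)
        _ = C := by rw [mul_assoc, ← Real.exp_add]; ring_nf; simp
    · intro y hy
      rw [norm_mul, norm_exp]
      have := hb ((1 - I) * (y * I)) (by simpa using hy)
      simp [abs_of_nonneg hy] at this ⊢
      calc _ ≤ _ := mul_le_mul_of_nonneg_right this (Real.exp_nonneg _)
        _ = C := by rw [mul_assoc, ← Real.exp_add]; ring_nf; simp
    · simp; linarith
    · simp; linarith
  have fin : ∀ u v : ℝ, ‖G z * exp ((u + v * I) * z)‖ ≤ C → u * z.re - v * z.im =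
      (A + c) * z.re + c * |z.im| → ‖G z‖ ≤ C * Real.exp (-(A + c) * z.re - c * |z.im|) := by
    intro u v h e
    rw [norm_mul, norm_exp, show ((u + v * I) * z).re = u * z.re - v * z.im by simp, e] at h
    rw [show -(A + c) * z.re - c * |z.im| = -((A + c) * z.re + c * |z.im|) by ring, Real.exp_neg,
      ← div_eq_mul_inv, le_div_iff₀ (Real.exp_pos _)]
    exact h
  -- Each quadrant now has rate `A + c` on its real edge and `c` on its imaginary edge; a factor
  -- `exp ((A + c ± c I) z)` compensates both at once.
  have re_bound : ∀ v x : ℝ, 0 ≤ x → ‖G x * exp (((A + c : ℝ) + v * I) * x)‖ ≤ C := by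
    intro v x hx
    rw [norm_mul, norm_exp]
    simp
    calc _ ≤ _ := mul_le_mul_of_nonneg_right (hray x hx) (Real.exp_nonneg _)
      _ = C := by rw [mul_assoc, ← Real.exp_add]; ring_nf; simp
  have im_bound : ∀ v x : ℝ, v * x = -(c * |x|) →
      ‖G (x * I) * exp (((A + c : ℝ) + v * I) * (x * I))‖ ≤ C := by
    intro v x hx
    rw [norm_mul, norm_exp]
    have := hb (x * I) (by simp)
    simp at this ⊢
    rw [hx, neg_neg]
    calc _ ≤ _ := mul_le_mul_of_nonneg_right this (Real.exp_nonneg _)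
      _ = C := by rw [mul_assoc, ← Real.exp_add]; ring_nf; simp
  rcases le_total 0 z.im with him | him
  · refine fin (A + c) (-c) ?_ (by rw [abs_of_nonneg him]; ring)
    have hsub : (Ioi 0 ×ℂ Ioi 0) ⊆ {z : ℂ | 0 < z.re} := fun z hz => (mem_reProdIm.1 hz).1
    have key := PhragmenLindelof.quadrant_I (C := C)
      (f := fun z => G z * exp (((A + c : ℝ) + (-c : ℝ) * I) * z)) (z := z)
      ((hG.mono hsub).smul (Differentiable.diffContOnCl (by fun_prop)))
      ⟨1, by norm_num, _, growth _ id _ fun z hz => (hsub hz).le⟩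
      (re_bound _) (fun x hx => im_bound _ x (by rw [abs_of_nonneg hx]; ring)) hz him
    simpa using key
  · refine fin (A + c) c ?_ (by rw [abs_of_nonpos him]; ring)
    have hsub : (Ioi 0 ×ℂ Iio 0) ⊆ {z : ℂ | 0 < z.re} := fun z hz => (mem_reProdIm.1 hz).1
    have key := PhragmenLindelof.quadrant_IV (C := C)
      (f := fun z => G z * exp (((A + c : ℝ) + (c : ℝ) * I) * z)) (z := z)
      ((hG.mono hsub).smul (Differentiable.diffContOnCl (by fun_prop)))
      ⟨1, by norm_num, _, growth _ id _ fun z hz => (hsub hz).le⟩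
      (re_bound _) (fun x hx => im_bound _ x (by rw [abs_of_nonpos hx]; ring)) hz him
    simpa using key

/-- A function holomorphic in the right half-plane which decays exponentially in `|Im z|` is zero. -/
theorem eq_zero_of_exp_decay {G : ℂ → ℂ} {C c : ℝ} (hc : 0 < c)
    (hG : DiffContOnCl ℂ G {z | 0 < z.re})
    (hb : ∀ z : ℂ, 0 ≤ z.re → ‖G z‖ ≤ C * Real.exp (-c * |z.im|)) (z : ℂ) (hz : 0 < z.re) :
    G z = 0 := by
  have step : ∀ n : ℕ, ∀ z : ℂ, 0 ≤ z.re →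
      ‖G z‖ ≤ C * Real.exp (-(n * c) * z.re - c * |z.im|) := by
    intro n
    induction n with
    | zero => intro z hz; simpa using hb z hz
    | succ n ih =>
      intro z hz
      have := norm_le_exp_step hc (by positivity) hG ih z hz
      convert this using 4
      push_cast; ring
  have lim : Filter.Tendsto (fun n : ℕ => C * Real.exp (-(n * c) * z.re - c * |z.im|))
      Filter.atTop (nhds (C * 0)) := by
    refine (Real.tendsto_exp_atBot.comp ?_).const_mul C
    refine Filter.tendsto_atBot_add_const_right _ _ ?_
    have : Filter.Tendsto (fun n : ℕ => (n : ℝ) * (c * z.re)) Filter.atTop Filter.atTop :=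
      tendsto_natCast_atTop_atTop.atTop_mul_const (by positivity)
    refine (Filter.tendsto_neg_atTop_atBot.comp this).congr fun n => ?_
    simp; ring
  have := ge_of_tendsto' lim fun n => step n z hz.le
  simpa using this

/-! ### Entire functions with the same zeros -/

open Filter Topology in
/-- Entire functions with the same zeros differ by a zero-free entire factor. -/
theorem exists_ne_zero_factor {F G : ℂ → ℂ} (hF : Differentiable ℂ F) (hG : Differentiable ℂ G)
    (hF0 : F ≠ 0) (h : ∀ z, analyticOrderAt F z = analyticOrderAt G z) :
    ∃ Q : ℂ → ℂ, Differentiable ℂ Q ∧ (∀ z, Q z ≠ 0) ∧ ∀ z, F z = Q z * G z := by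
  have hFa : ∀ z, AnalyticAt ℂ F z := fun z => hF.analyticAt z
  have hGa : ∀ z, AnalyticAt ℂ G z := fun z => hG.analyticAt z
  have hFt : ∀ z, analyticOrderAt F z ≠ ⊤ := fun z hz =>
    hF0 ((AnalyticOnNhd.analyticOrderAt_eq_top_iff_eq_zero z hFa).1 hz)
  have hm : MeromorphicOn (F / G) univ := fun z _ =>
    (hFa z).meromorphicAt.div (hGa z).meromorphicAt
  -- `F / G` takes the junk value `0` at zeros of `G`; the normal form repairs these points. Equal
  -- orders make every order of `Q` zero, so `Q` is analytic and zero-free.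
  set Q := toMeromorphicNFOn (F / G) univ with hQ
  have hQn : ∀ z, MeromorphicNFAt Q z := fun z => meromorphicNFOn_toMeromorphicNFOn _ _ (mem_univ z)
  have hQ0 : ∀ z, meromorphicOrderAt Q z = 0 := by
    intro z
    rw [hQ, meromorphicOrderAt_toMeromorphicNFOn hm (mem_univ z),
      meromorphicOrderAt_div (hFa z).meromorphicAt (hGa z).meromorphicAt,
      (hFa z).meromorphicOrderAt_eq, (hGa z).meromorphicOrderAt_eq, ← h z]
    obtain ⟨n, hn⟩ := ENat.ne_top_iff_exists.1 (hFt z)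
    rw [← hn]
    simp
  have hQa : ∀ z, AnalyticAt ℂ Q z := fun z =>
    (hQn z).meromorphicOrderAt_nonneg_iff_analyticAt.1 (hQ0 z).ge
  refine ⟨Q, fun z => (hQa z).differentiableAt, fun z =>
    (hQn z).meromorphicOrderAt_eq_zero_iff.1 (hQ0 z), fun z => ?_⟩
  have hGne : ∀ᶠ w in 𝓝[≠] z, G w ≠ 0 :=
    (hGa z).eventually_eq_zero_or_eventually_ne_zero.resolve_left fun h0 =>
      hFt z (by rw [h z]; exact analyticOrderAt_eq_top.2 h0)
  have hev : ∀ᶠ w in 𝓝[≠] z, F w = Q w * G w := by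
    filter_upwards [hGne, hm.toMeromorphicNFOn_eq_self_on_nhdsNE (mem_univ z)] with w hw hw'
    rw [hQ, hw']
    simp [div_mul_cancel₀ _ hw]
  exact (((hFa z).frequently_eq_iff_eventually_eq ((hQa z).mul (hGa z))).1 hev.frequently).self_of_nhds

open Complex in
/-- A zero-free entire function is the exponential of an entire function. -/
theorem exists_exp_eq {Q : ℂ → ℂ} (hQ : Differentiable ℂ Q) (h0 : ∀ z, Q z ≠ 0) :
    ∃ h : ℂ → ℂ, Differentiable ℂ h ∧ ∀ z, Q z = exp (h z) := by
  have hL : Differentiable ℂ fun z => deriv Q z / Q z := fun z =>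
    (((hQ.analyticAt z).deriv).differentiableAt).div (hQ z) (h0 z)
  obtain ⟨p, hp⟩ := hL.isExactOn_univ
  have hp' : ∀ z, HasDerivAt p (deriv Q z / Q z) z := fun z => hp z (mem_univ z)
  have hd : ∀ z, HasDerivAt (fun z => Q z * exp (-p z)) 0 z := by
    intro z
    refine ((hQ z).hasDerivAt.fun_mul (hp' z).fun_neg.cexp).congr_deriv ?_
    have e : Q z * (deriv Q z / Q z) = deriv Q z := mul_div_cancel₀ _ (h0 z)
    linear_combination -exp (-p z) * e
  have hc : ∀ z, Q z * exp (-p z) = Q 0 * exp (-p 0) := fun z =>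
    is_const_of_deriv_eq_zero (fun z => (hd z).differentiableAt) (fun z => (hd z).deriv) z 0
  obtain ⟨b, hb⟩ : ∃ b, exp b = Q 0 * exp (-p 0) :=
    ⟨_, exp_log (mul_ne_zero (h0 0) (exp_ne_zero _))⟩
  refine ⟨fun z => p z + b, fun z => (hp' z).differentiableAt.add_const _, fun z => ?_⟩
  rw [exp_add, hb, ← hc z, mul_left_comm, ← exp_add, add_neg_cancel, exp_zero, mul_one]

open Real in
/-- The circle averages of `|log ‖F‖|` are controlled by the maximum of `‖F‖` (a consequence of
Jensen's formula). -/
theorem circleAverage_abs_log_norm_le {F : ℂ → ℂ} (hF : Differentiable ℂ F) {c : ℂ} (hc : F c ≠ 0)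
    {R B : ℝ} (hR : 0 < R) (hB : 0 ≤ B) (hb : ∀ z ∈ Metric.sphere c R, ‖F z‖ ≤ exp B) :
    circleAverage (fun z => |log ‖F z‖|) c R ≤ 2 * B - log ‖F c‖ := by
  have hFa : ∀ S, AnalyticOnNhd ℂ F S := fun S z _ => hF.analyticAt z
  have hint : CircleIntegrable (fun z => log ‖F z‖) c R :=
    MeromorphicOn.circleIntegrable_log_norm (hFa _).meromorphicOn
  -- In Jensen's formula the zeros contribute only nonnegative terms.
  have hj : log ‖F c‖ ≤ circleAverage (fun z => log ‖F z‖) c R := by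
    rw [AnalyticOnNhd.circleAverage_log_norm hR.ne' (hFa _) hc, le_add_iff_nonneg_left]
    refine finsum_nonneg fun u => ?_
    by_cases hu : u ∈ Metric.closedBall c |R|
    · refine mul_nonneg ?_ ?_
      · have := MeromorphicOn.AnalyticOnNhd.divisor_nonneg (hFa (Metric.closedBall c |R|))
        exact_mod_cast this u
      · rcases eq_or_ne c u with rfl | hne
        · simp
        · refine log_nonneg ?_
          rw [← div_eq_mul_inv, one_le_div (norm_pos_iff.2 (sub_ne_zero.2 hne))]
          rw [Metric.mem_closedBall, dist_comm, dist_eq_norm, abs_of_pos hR] at hu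
          exact hu
    · rw [Function.locallyFinsuppWithin.apply_eq_zero_of_notMem _ hu]
      simp
  -- Pointwise, `x ≤ B` and `0 ≤ B` give `|x| ≤ 2 B - x`.
  have hle : circleAverage (fun z => |log ‖F z‖|) c R ≤
      circleAverage (fun z => 2 * B - log ‖F z‖) c R := by
    refine circleAverage_mono hint.abs ((circleIntegrable_const _ _ _).sub hint) fun z hz => ?_
    rw [abs_of_pos hR] at hz
    have hlog : log ‖F z‖ ≤ B := by
      rcases eq_or_ne (F z) 0 with h0 | h0
      · simpa [h0] using hB
      · exact (log_le_iff_le_exp (norm_pos_iff.2 h0)).2 (hb z hz)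
    rw [abs_le]
    constructor <;> linarith
  rw [circleAverage_fun_sub (circleIntegrable_const _ _ _) hint, circleAverage_const] at hle
  linarith

open Complex in
/-- The second derivative of an entire function is controlled by circle averages of the absolute
value of its real part. -/
theorem norm_iteratedDeriv_two_le {h : ℂ → ℂ} (hh : Differentiable ℂ h) (c : ℂ) {R : ℝ}
    (hR : 0 < R) :
    ‖iteratedDeriv 2 h c‖ ≤ 4 / R ^ 2 * Real.circleAverage (fun z => |(h z).re|) c R := by
  have hcont : ∀ {u : ℂ → ℂ}, ContinuousOn u (Metric.sphere c R) → CircleIntegrable u c R :=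
    fun hu => hu.circleIntegrable hR.le
  have hne : ∀ z ∈ Metric.sphere c R, z - c ≠ 0 := fun z hz h0 => by
    rw [mem_sphere_iff_norm, h0, norm_zero] at hz
    exact hR.ne hz
  have e1 : Real.circleAverage (fun z => h z / (z - c) ^ 2) c R = iteratedDeriv 2 h c / 2 := by
    rw [Real.circleAverage_eq_circleIntegral hR.ne']
    have := hh.differentiableOn.circleIntegral_one_div_sub_center_pow_smul (c := c) hR 2
    rw [show (fun z => (z - c)⁻¹ • (h z / (z - c) ^ 2)) =
      fun z => (1 / (z - c) ^ (2 + 1)) • h z by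
        ext z; simp only [smul_eq_mul]; simp only [div_eq_mul_inv, ← inv_pow]; ring, this]
    have := two_pi_I_ne_zero
    simp only [smul_eq_mul, Nat.factorial]
    push_cast
    field_simp
  have e2 : Real.circleAverage (fun z => h z * (z - c) ^ 2) c R = 0 := by
    have := DiffContOnCl.circleAverage (f := fun z => h z * (z - c) ^ 2) (c := c) (R := R)
      (Differentiable.diffContOnCl (by fun_prop))
    simpa using this
  -- On the circle `1 / (z - c)^2` is `conj ((z - c)^2) / R^4`, so this average is a multiple of the
  -- conjugate of the one in `e2`. Adding it to Cauchy's formula replaces `h` by `h + conj h = 2 Re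
  -- h`.
  have e3 : Real.circleAverage (fun z => (starRingEnd ℂ) (h z) / (z - c) ^ 2) c R = 0 := by
    have h1 := ContinuousLinearMap.circleAverage_comp_comm
      (conjCLE : ℂ →L[ℝ] ℂ) (hcont (u := fun z => h z * (z - c) ^ 2)
        (by have := hh.continuous; fun_prop))
    rw [e2, map_zero] at h1
    have h2 : Real.circleAverage (fun z => (starRingEnd ℂ) (h z) / (z - c) ^ 2) c R =
        Real.circleAverage (((R : ℂ) ^ 4)⁻¹ •
          (((conjCLE : ℂ →L[ℝ] ℂ)) ∘ fun z => h z * (z - c) ^ 2)) c R := by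
      refine Real.circleAverage_congr_sphere fun z hz => ?_
      rw [abs_of_pos hR] at hz
      have hz0 := hne z hz
      have hz' : (starRingEnd ℂ) (z - c) * (z - c) = (R : ℂ) ^ 2 := by
        rw [mul_comm, mul_conj, normSq_eq_norm_sq, mem_sphere_iff_norm.1 hz]
        push_cast; rfl
      have hR0 : (R : ℂ) ≠ 0 := ofReal_ne_zero.2 hR.ne'
      simp only [Pi.smul_apply, Function.comp, smul_eq_mul, ContinuousLinearEquiv.coe_coe,
        conjCLE_apply, map_mul, map_pow]
      rw [show (R : ℂ) ^ 4 = ((R : ℂ) ^ 2) ^ 2 by ring, ← hz']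
      have : (starRingEnd ℂ) (z - c) ≠ 0 := (map_ne_zero _).2 hz0
      field_simp
    rw [h2, Real.circleAverage_smul, h1, smul_zero]
  have hc1 : CircleIntegrable (fun z => h z / (z - c) ^ 2) c R :=
    hcont (hh.continuous.continuousOn.div (by fun_prop) fun z hz => pow_ne_zero _ (hne z hz))
  have hc2 : CircleIntegrable (fun z => (starRingEnd ℂ) (h z) / (z - c) ^ 2) c R :=
    hcont ((continuous_conj.comp hh.continuous).continuousOn.div (by fun_prop)
      fun z hz => pow_ne_zero _ (hne z hz))
  have e4 := Real.circleAverage_fun_add hc1 hc2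
  rw [e1, e3, add_zero] at e4
  have e5 : ‖iteratedDeriv 2 h c / 2‖ ≤
      2 / R ^ 2 * Real.circleAverage (fun z => |(h z).re|) c R := by
    rw [← e4, Real.circleAverage_def, Real.circleAverage_def, norm_smul, smul_eq_mul,
      mul_left_comm, Real.norm_of_nonneg (by positivity)]
    refine mul_le_mul_of_nonneg_left ?_ (by positivity)
    refine (intervalIntegral.norm_integral_le_integral_norm (by positivity)).trans_eq ?_
    rw [← intervalIntegral.integral_const_mul]
    refine intervalIntegral.integral_congr fun θ _ => ?_
    rw [← add_div, add_conj, norm_div, norm_pow, circleMap_sub_center, norm_circleMap_zero,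
      norm_real, Real.norm_eq_abs, abs_mul, sq_abs, abs_two]
    ring
  rw [norm_div, RCLike.norm_ofNat] at e5
  linear_combination 2 * e5

open Complex Filter Topology in
/-- Two entire functions with the same zeros whose growth is of order less than two differ by an
exponential factor. -/
theorem exists_eq_exp_mul {F G : ℂ → ℂ} (hF : Differentiable ℂ F) (hG : Differentiable ℂ G)
    (hF0 : F ≠ 0) (h : ∀ z, analyticOrderAt F z = analyticOrderAt G z) {A : ℝ} (hA : 0 ≤ A)
    (hFb : ∀ z, ‖F z‖ ≤ Real.exp (A * (1 + ‖z‖) ^ (3 / 2 : ℝ)))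
    (hGb : ∀ z, ‖G z‖ ≤ Real.exp (A * (1 + ‖z‖) ^ (3 / 2 : ℝ))) :
    ∃ α β : ℂ, ∀ z, F z = exp (α * z + β) * G z := by
  obtain ⟨Q, hQ, hQ0, hFQ⟩ := exists_ne_zero_factor hF hG hF0 h
  obtain ⟨p, hp, hQp⟩ := exists_exp_eq hQ hQ0
  have hFG : ∀ z, F z = exp (p z) * G z := fun z => by rw [hFQ, hQp]
  obtain ⟨c₀, hc₀⟩ := Function.ne_iff.1 hF0
  have hzero : ∀ c, F c ≠ 0 → iteratedDeriv 2 p c = 0 := by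
    intro c hc
    have hc' : G c ≠ 0 := fun h0 => hc (by rw [hFG, h0, mul_zero])
    -- With `Re p = log ‖F‖ - log ‖G‖`, the bound is `O(R ^ (3/2) / R ^ 2)`, which tends to `0`.
    have key : ∀ R : ℝ, 0 < R → ‖iteratedDeriv 2 p c‖ ≤ 4 / R ^ 2 *
        (4 * (A * (1 + ‖c‖ + R) ^ (3 / 2 : ℝ)) - Real.log ‖F c‖ - Real.log ‖G c‖) := by
      intro R hR
      refine (norm_iteratedDeriv_two_le hp c hR).trans ?_
      refine mul_le_mul_of_nonneg_left ?_ (by positivity)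
      have hs : ∀ z ∈ Metric.sphere c R, A * (1 + ‖z‖) ^ (3 / 2 : ℝ) ≤
          A * (1 + ‖c‖ + R) ^ (3 / 2 : ℝ) := by
        intro z hz
        have : ‖z‖ ≤ ‖c‖ + R := by
          rw [← mem_sphere_iff_norm.1 hz]
          simpa using norm_add_le c (z - c)
        exact mul_le_mul_of_nonneg_left
          (Real.rpow_le_rpow (by positivity) (by linarith) (by norm_num)) hA
      have hB : 0 ≤ A * (1 + ‖c‖ + R) ^ (3 / 2 : ℝ) := by positivity
      have bF := circleAverage_abs_log_norm_le hF hc hR hB fun z hz =>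
        (hFb z).trans (Real.exp_le_exp.2 (hs z hz))
      have bG := circleAverage_abs_log_norm_le hG hc' hR hB fun z hz =>
        (hGb z).trans (Real.exp_le_exp.2 (hs z hz))
      have iF : CircleIntegrable (fun z => Real.log ‖F z‖) c R :=
        MeromorphicOn.circleIntegrable_log_norm fun z _ => (hF.analyticAt z).meromorphicAt
      have iG : CircleIntegrable (fun z => Real.log ‖G z‖) c R :=
        MeromorphicOn.circleIntegrable_log_norm fun z _ => (hG.analyticAt z).meromorphicAt
      have jF : CircleIntegrable (fun z => |Real.log ‖F z‖|) c R := iF.abs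
      have jG : CircleIntegrable (fun z => |Real.log ‖G z‖|) c R := iG.abs
      have hcong : Real.circleAverage (fun z => |(p z).re|) c R =
          Real.circleAverage (fun z => |Real.log ‖F z‖ - Real.log ‖G z‖|) c R := by
        -- The circle may meet zeros of `G`, where the logarithmic identity can fail; they form a
        -- discrete set and do not affect the average.
        refine Real.circleAverage_congr_codiscreteWithin ?_ hR.ne'
        have hcod : G ⁻¹' {0}ᶜ ∈ codiscreteWithin (Metric.sphere c |R|) :=
          codiscreteWithin_mono (subset_univ _)
            (AnalyticOnNhd.preimage_zero_mem_codiscrete (fun z _ => hG.analyticAt z) hc')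
        filter_upwards [hcod] with z hz
        rw [hFG z, norm_mul, Real.log_mul (norm_ne_zero_iff.2 (exp_ne_zero _))
          (norm_ne_zero_iff.2 hz), norm_exp, Real.log_exp, add_sub_cancel_right]
      have hle : Real.circleAverage (fun z => |Real.log ‖F z‖ - Real.log ‖G z‖|) c R ≤
          Real.circleAverage (fun z => |Real.log ‖F z‖| + |Real.log ‖G z‖|) c R :=
        Real.circleAverage_mono (iF.sub iG).abs (jF.add jG) fun z _ => abs_sub _ _
      rw [Real.circleAverage_fun_add jF jG] at hle
      rw [hcong]
      linarith
    have l1 : Tendsto (fun R : ℝ => (1 + ‖c‖ + R) ^ (3 / 2 : ℝ) / R ^ 2) atTop (𝓝 0) := by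
      have hq : Tendsto (fun R : ℝ => (2 : ℝ) ^ (3 / 2 : ℝ) * R ^ (-(1 / 2) : ℝ)) atTop
          (𝓝 (2 ^ (3 / 2 : ℝ) * 0)) :=
        (tendsto_rpow_neg_atTop (by norm_num)).const_mul _
      rw [mul_zero] at hq
      refine squeeze_zero' ?_ ?_ hq
      · filter_upwards [eventually_ge_atTop 0] with R hR
        positivity
      · filter_upwards [eventually_ge_atTop (1 + ‖c‖)] with R hR
        have hR0 : 0 < R := lt_of_lt_of_le (by positivity) hR
        rw [div_le_iff₀ (by positivity), mul_assoc, ← Real.rpow_natCast R 2, ← Real.rpow_add hR0,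
          show (-(1 / 2) + (2 : ℕ) : ℝ) = 3 / 2 by norm_num, ← Real.mul_rpow (by norm_num) hR0.le]
        exact Real.rpow_le_rpow (by positivity) (by linarith) (by norm_num)
    have l2 : Tendsto (fun R : ℝ => 4 / R ^ 2 *
        (4 * (A * (1 + ‖c‖ + R) ^ (3 / 2 : ℝ)) - Real.log ‖F c‖ - Real.log ‖G c‖)) atTop (𝓝 0) := by
      have l3 : Tendsto (fun R : ℝ => (1 : ℝ) / R ^ 2) atTop (𝓝 0) := by
        simpa using tendsto_pow_neg_atTop (𝕜 := ℝ) (n := 2) (by norm_num)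
      have := (l1.const_mul (16 * A)).sub (l3.const_mul (4 * (Real.log ‖F c‖ + Real.log ‖G c‖)))
      simp only [mul_zero, sub_zero] at this
      refine this.congr fun R => ?_
      ring
    have := ge_of_tendsto l2 ((eventually_gt_atTop 0).mono key)
    exact norm_le_zero_iff.1 this
  have h2 : Differentiable ℂ (iteratedDeriv 2 p) := by
    simpa [iteratedDeriv_succ] using
      (hp.contDiff (n := 3)).differentiable_iteratedDeriv 2 (by norm_cast)
  -- The estimate covers only points where `F ≠ 0`, but these contain a neighbourhood of `c₀`.
  have hd2 : ∀ z, iteratedDeriv 2 p z = 0 := by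
    have := AnalyticOnNhd.eq_of_eventuallyEq (z₀ := c₀) (f := iteratedDeriv 2 p) (g := fun _ => 0)
      (fun z _ => h2.analyticAt z) (fun z _ => analyticAt_const)
      ((hF.continuous.continuousAt.eventually_ne hc₀).mono fun z hz => hzero z hz)
    exact fun z => congrFun this z
  have hdp : Differentiable ℂ (deriv p) := fun z => (hp.analyticAt z).deriv.differentiableAt
  have hα : ∀ z, deriv p z = deriv p 0 := fun z =>
    is_const_of_deriv_eq_zero hdp (fun w => by
      simpa [iteratedDeriv_succ] using hd2 w) z 0
  have hlin : ∀ z, p z - deriv p 0 * z = p 0 - deriv p 0 * 0 := fun z =>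
    is_const_of_deriv_eq_zero (f := fun z => p z - deriv p 0 * z) (by fun_prop) (fun w => by
      have := ((hp w).hasDerivAt.sub ((hasDerivAt_id w).const_mul (deriv p 0))).deriv
      simp only [hα w, mul_one, sub_self] at this
      exact this) z 0
  refine ⟨deriv p 0, p 0, fun z => ?_⟩
  rw [hFG z]
  congr 2
  linear_combination hlin z

/-! ### Injectivity of the Fourier and Mellin transforms -/

/-- An integrable function on the real line with zero Fourier transform is zero. -/
theorem ae_eq_zero_of_fourier_eq_zero {h : ℝ → ℂ} (hi : Integrable h) (h0 : ∀ ξ, 𝓕 h ξ = 0) :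
    ∀ᵐ x, h x = 0 := by
  refine ae_eq_zero_of_integral_contDiff_smul_eq_zero hi.locallyIntegrable fun g hg hgs => ?_
  have hgs' : HasCompactSupport fun x => (g x : ℂ) := hgs.comp_left Complex.ofReal_zero
  -- Every test function is the Fourier transform of a Schwartz function `φ`, so the multiplication
  -- formula moves the transform onto `h`.
  set ψ : SchwartzMap ℝ ℂ := hgs'.toSchwartzMap (Complex.ofRealCLM.contDiff.comp hg) with hψ
  set φ : SchwartzMap ℝ ℂ := 𝓕⁻ ψ with hφ
  have key := VectorFourier.integral_fourierIntegral_smul_eq_flip (L := innerₗ ℝ)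
    Real.continuous_fourierChar continuous_inner (φ.integrable (μ := volume)) hi
  have e1 : ∀ ξ, VectorFourier.fourierIntegral Real.fourierChar volume (innerₗ ℝ) (φ : ℝ → ℂ) ξ
      = g ξ := by
    intro ξ
    have : 𝓕 φ = ψ := by rw [hφ, FourierTransform.fourier_fourierInv_eq]
    have := DFunLike.congr_fun this ξ
    rw [SchwartzMap.fourier_coe] at this
    exact this
  have e2 : ∀ ξ, VectorFourier.fourierIntegral Real.fourierChar volume (innerₗ ℝ).flip h ξ = 0 := by
    intro ξ
    rw [flip_innerₗ]
    exact h0 ξ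
  simp only [e1, e2, smul_zero, integral_zero] at key
  simpa using key

theorem exp_neg_image_univ : (fun u : ℝ => Real.exp (-u)) '' univ = Ioi 0 := by
  ext x
  refine ⟨?_, fun hx => ⟨-Real.log x, trivial, by simp [Real.exp_log (mem_Ioi.1 hx)]⟩⟩
  rintro ⟨u, -, rfl⟩
  exact Real.exp_pos _

/-- Injectivity of the Mellin transform on a vertical line, at the abscissa `0`. -/
theorem ae_eq_zero_of_mellin_eq_zero {f : ℝ → ℂ} (hf : MellinConvergent f 0)
    (h0 : ∀ y : ℝ, mellin f (y * Complex.I) = 0) :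
    ∀ᵐ t ∂(volume.restrict (Ioi (0 : ℝ))), f t = 0 := by
  -- The substitution `t = exp (-u)` turns the Mellin transform on the imaginary axis into a Fourier
  -- transform.
  have hd : ∀ x ∈ univ, HasDerivWithinAt (fun u : ℝ => Real.exp (-u)) (-Real.exp (-x)) univ x :=
    fun x _ => ((hasDerivAt_neg x).exp.congr_deriv (by simp)).hasDerivWithinAt
  have hinj : InjOn (fun u : ℝ => Real.exp (-u)) univ := fun x _ y _ h => by simpa using h
  have hi : Integrable fun u : ℝ => f (Real.exp (-u)) := by
    rw [MellinConvergent, ← exp_neg_image_univ, integrableOn_image_iff_integrableOn_abs_deriv_smul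
      MeasurableSet.univ hd hinj, integrableOn_univ] at hf
    refine hf.congr (Filter.Eventually.of_forall fun x => ?_)
    have : (Real.exp (-x) : ℂ) ≠ 0 := by exact_mod_cast (Real.exp_pos _).ne'
    simp only [abs_neg, abs_of_pos (Real.exp_pos _), zero_sub, Complex.cpow_neg_one, smul_eq_mul,
      Complex.real_smul]
    rw [mul_inv_cancel_left₀ this]
  have hz := ae_eq_zero_of_fourier_eq_zero hi fun ξ => by
    have := h0 (2 * Real.pi * ξ : ℝ)
    rw [mellin_eq_fourier] at this
    simp at this
    exact this
  -- The almost-everywhere statement returns to the variable `t` through the vanishing integral of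
  -- `t⁻¹ ‖f t‖`.
  have hn : ∫ t in Ioi (0 : ℝ), t⁻¹ * ‖f t‖ = 0 := by
    rw [← exp_neg_image_univ, integral_image_eq_integral_abs_deriv_smul MeasurableSet.univ hd hinj,
      Measure.restrict_univ]
    refine integral_eq_zero_of_ae ?_
    filter_upwards [hz] with u hu
    simp [hu]
  have hin : IntegrableOn (fun t => t⁻¹ * ‖f t‖) (Ioi 0) := by
    refine (Integrable.norm hf).congr ?_
    filter_upwards [ae_restrict_mem measurableSet_Ioi] with t ht
    simp [Complex.cpow_neg_one, abs_of_pos (mem_Ioi.1 ht)]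
  rw [setIntegral_eq_zero_iff_of_nonneg_ae ?_ hin] at hn
  · filter_upwards [hn, ae_restrict_mem measurableSet_Ioi] with t ht ht0
    simpa [(mem_Ioi.1 ht0).ne'] using ht
  · filter_upwards [ae_restrict_mem measurableSet_Ioi] with t ht
    have := mem_Ioi.1 ht
    simp only [Pi.zero_apply]
    positivity

/-! ### The `L²` Fourier transform and parity -/

open scoped InnerProductSpace in
/-- Integration against a square-integrable function is continuous on `L²`. -/
theorem continuous_integral_mul {G : ℝ → ℂ} (hG : MemLp G 2) :
    Continuous fun F : Lp ℂ 2 (volume : Measure ℝ) => ∫ x, F x * G x := by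
  have hG' : MemLp (fun x => (starRingEnd ℂ) (G x)) 2 := hG.star
  have : (fun F : Lp ℂ 2 (volume : Measure ℝ) => ∫ x, F x * G x) =
      fun F => ⟪hG'.toLp _, F⟫_ℂ := by
    ext F
    rw [L2.inner_def]
    refine integral_congr_ae ?_
    filter_upwards [hG'.coeFn_toLp] with x hx
    rw [hx, RCLike.inner_apply, RCLike.conj_conj]
  rw [this]
  fun_prop

/-- The multiplication formula for the `L²` Fourier transform. -/
theorem integral_fourier_mul_eq (F : Lp ℂ 2 (volume : Measure ℝ)) {G : ℝ → ℂ}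
    (hG1 : Integrable G) (hG : MemLp G 2) (hFG : MemLp (𝓕 G) 2) :
    ∫ x, (𝓕 F : Lp ℂ 2 (volume : Measure ℝ)) x * G x = ∫ x, F x * 𝓕 G x := by
  refine DenseRange.induction_on (p := fun F : Lp ℂ 2 (volume : Measure ℝ) =>
    ∫ x, (𝓕 F : Lp ℂ 2 (volume : Measure ℝ)) x * G x = ∫ x, F x * 𝓕 G x)
    (SchwartzMap.denseRange_toLpCLM (p := 2) (μ := volume) ENNReal.ofNat_ne_top) F ?_ ?_
  · refine isClosed_eq ?_ (continuous_integral_mul hFG)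
    exact (continuous_integral_mul hG).comp
      (MeasureTheory.Lp.fourierTransformₗᵢ ℝ ℂ).continuous
  · intro φ
    have key := VectorFourier.integral_fourierIntegral_smul_eq_flip (L := innerₗ ℝ)
      Real.continuous_fourierChar continuous_inner (φ.integrable (μ := volume)) hG1
    rw [flip_innerₗ] at key
    rw [SchwartzMap.toLpCLM_apply, SchwartzMap.toLp_fourier_eq]
    have e1 : ∫ x, (𝓕 φ).toLp 2 volume x * G x = ∫ x, 𝓕 φ x * G x := by
      refine integral_congr_ae ?_
      filter_upwards [(𝓕 φ).coeFn_toLp 2 volume] with x hx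
      rw [hx]
    have e2 : ∫ x, φ.toLp 2 volume x * 𝓕 G x = ∫ x, φ x * 𝓕 G x := by
      refine integral_congr_ae ?_
      filter_upwards [φ.coeFn_toLp 2 volume] with x hx
      rw [hx]
    rw [e1, e2]
    exact key

theorem evenExt_coeFn (f : HalfLineL2) : evenExt f =ᵐ[volume] fun x => f |x| :=
  (memLp_comp_abs f).coeFn_toLp

theorem evenExt_neg (f : HalfLineL2) : ∀ᵐ x : ℝ, evenExt f (-x) = evenExt f x := by
  have h := evenExt_coeFn f
  filter_upwards [h, (Measure.measurePreserving_neg volume).quasiMeasurePreserving.ae h]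
    with x h1 h2
  rw [h1, h2, abs_neg]

/-- The Fourier transform of an even square-integrable function is even. -/
theorem fourier_evenExt_neg (f : HalfLineL2) :
    ∀ᵐ x : ℝ, (𝓕 (evenExt f) : Lp ℂ 2 (volume : Measure ℝ)) (-x) =
      (𝓕 (evenExt f) : Lp ℂ 2 (volume : Measure ℝ)) x := by
  set F := evenExt f
  have hm : MemLp (𝓕 F : Lp ℂ 2 (volume : Measure ℝ)) 2 volume := Lp.memLp _
  have hm' : MemLp (fun x => (𝓕 F : Lp ℂ 2 (volume : Measure ℝ)) (-x)) 2 volume :=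
    hm.comp_measurePreserving (Measure.measurePreserving_neg volume)
  refine ae_eq_of_integral_contDiff_smul_eq (hm'.locallyIntegrable (by norm_num))
    (hm.locallyIntegrable (by norm_num)) fun g hg hgs => ?_
  have hgs' : HasCompactSupport fun x => (g x : ℂ) := hgs.comp_left Complex.ofReal_zero
  set ψ : SchwartzMap ℝ ℂ := hgs'.toSchwartzMap (Complex.ofRealCLM.contDiff.comp hg) with hψ
  have hψg : ∀ x, ψ x = g x := fun x => rfl
  have hF : ∀ ξ, 𝓕 (fun x => ψ (-x)) ξ = 𝓕 (ψ : ℝ → ℂ) (-ξ) := fun ξ =>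
    Real.fourier_comp_linearIsometry (LinearIsometryEquiv.neg ℝ) ψ ξ
  have hψ2 : MemLp ψ 2 := ψ.memLp 2
  have hFψ2 : MemLp (𝓕 (ψ : ℝ → ℂ)) 2 := by
    rw [← SchwartzMap.fourier_coe]; exact (𝓕 ψ).memLp 2
  have e1 := integral_fourier_mul_eq F ψ.integrable hψ2 hFψ2
  have e2 := integral_fourier_mul_eq F (G := fun x => ψ (-x)) ψ.integrable.comp_neg
    (hψ2.comp_measurePreserving (Measure.measurePreserving_neg volume)) (by
      rw [funext hF]
      exact hFψ2.comp_measurePreserving (Measure.measurePreserving_neg volume))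
  -- Reflecting the test function reflects its Fourier transform, which the evenness of `F` absorbs.
  have e3 : ∫ x, F x * 𝓕 (fun x => ψ (-x)) x = ∫ x, F x * 𝓕 (ψ : ℝ → ℂ) x := by
    rw [← integral_neg_eq_self]
    refine integral_congr_ae ?_
    filter_upwards [evenExt_neg f] with x hx
    rw [hx, hF, neg_neg]
  rw [e3, ← e1, ← integral_neg_eq_self] at e2
  simp only [neg_neg, hψg] at e2
  simpa [Complex.real_smul, mul_comm] using e2

/-! ### The theta transform and its decay -/

/-- The theta transform `y ↦ ∫₀^∞ f(t) exp (-π y t²) dt`. -/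
noncomputable def theta (f : HalfLineL2) (y : ℝ) : ℂ :=
  ∫ t in Ioi (0 : ℝ), f t * Complex.exp (-Real.pi * y * t ^ 2)

theorem integrable_gaussian {y : ℝ} (hy : 0 < y) :
    Integrable fun t : ℝ => Complex.exp (-Real.pi * y * t ^ 2) := by
  have := integrable_cexp_neg_mul_sq (b := (Real.pi * y : ℝ)) (by
    rw [Complex.ofReal_re]; positivity)
  simpa [neg_mul] using this

theorem norm_gaussian (y t : ℝ) :
    ‖Complex.exp (-Real.pi * y * t ^ 2)‖ = Real.exp (-Real.pi * y * t ^ 2) := by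
  rw [Complex.norm_exp]
  norm_cast

theorem memLp_gaussian {y : ℝ} (hy : 0 < y) :
    MemLp (fun t : ℝ => Complex.exp (-Real.pi * y * t ^ 2)) 2 := by
  rw [memLp_two_iff_integrable_sq_norm (integrable_gaussian hy).1]
  refine (integrable_gaussian (y := 2 * y) (by positivity)).norm.congr
    (Filter.Eventually.of_forall fun t => ?_)
  simp only [norm_gaussian, ← Real.exp_nat_mul]
  congr 1
  push_cast
  ring

theorem integrable_mul_gaussian (f : HalfLineL2) {y : ℝ} (hy : 0 < y) :
    IntegrableOn (fun t : ℝ => f t * Complex.exp (-Real.pi * y * t ^ 2)) (Ioi 0) :=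
  (Lp.memLp f).integrable_mul ((memLp_gaussian hy).restrict _)

theorem integral_even_eq {H : ℝ → ℂ} (hi : Integrable H) (he : ∀ᵐ x : ℝ, H (-x) = H x) :
    ∫ x, H x = 2 * ∫ x in Ioi (0 : ℝ), H x := by
  rw [← intervalIntegral.integral_Iic_add_Ioi (b := 0) hi.integrableOn hi.integrableOn, two_mul]
  congr 1
  have := integral_comp_neg_Ioi (0 : ℝ) H
  rw [neg_zero] at this
  rw [← this]
  exact integral_congr_ae (ae_restrict_of_ae he)

theorem integral_even_mul_gaussian {F : Lp ℂ 2 (volume : Measure ℝ)}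
    (he : ∀ᵐ x : ℝ, F (-x) = F x) {f : HalfLineL2}
    (hf : ∀ᵐ t ∂(volume.restrict (Ioi (0 : ℝ))), f t = F t) {y : ℝ} (hy : 0 < y) :
    ∫ x, F x * Complex.exp (-Real.pi * y * x ^ 2) = 2 * theta f y := by
  have hi : Integrable fun x : ℝ => F x * Complex.exp (-Real.pi * y * x ^ 2) :=
    (Lp.memLp F).integrable_mul (memLp_gaussian hy)
  rw [integral_even_eq hi, theta]
  · congr 1
    refine integral_congr_ae ?_
    filter_upwards [hf] with t ht
    simp [ht]
  · filter_upwards [he] with x hx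
    simp [hx]

theorem cosTransform_coeFn (f : HalfLineL2) :
    ∀ᵐ t ∂(volume.restrict (Ioi (0 : ℝ))),
      cosTransform f t = (𝓕 (evenExt f) : Lp ℂ 2 (volume : Measure ℝ)) t :=
  MemLp.coeFn_toLp _

theorem evenExt_coeFn_Ioi (f : HalfLineL2) :
    ∀ᵐ t ∂(volume.restrict (Ioi (0 : ℝ))), f t = evenExt f t := by
  filter_upwards [ae_restrict_of_ae (evenExt_coeFn f), ae_restrict_mem measurableSet_Ioi]
    with t ht h0
  rw [ht, abs_of_pos h0]

/-- The theta transforms of `f` and its cosine transform are exchanged by `y ↦ 1 / y`. -/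
theorem theta_cosTransform (f : HalfLineL2) {y : ℝ} (hy : 0 < y) :
    theta (cosTransform f) y = 1 / (y : ℂ) ^ (1 / 2 : ℂ) * theta f (1 / y) := by
  have hfg := fourier_gaussian_pi (b := y) (by simpa using hy)
  have hfg' : (𝓕 fun x : ℝ => Complex.exp (-Real.pi * y * x ^ 2)) = fun t : ℝ =>
      1 / (y : ℂ) ^ (1 / 2 : ℂ) * Complex.exp (-Real.pi * (1 / y : ℝ) * t ^ 2) := by
    rw [hfg]
    ext t
    push_cast
    ring_nf
  have key := integral_fourier_mul_eq (evenExt f) (integrable_gaussian hy) (memLp_gaussian hy) (by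
    rw [hfg']; exact (memLp_gaussian (by positivity)).const_mul _)
  rw [integral_even_mul_gaussian (fourier_evenExt_neg f) (cosTransform_coeFn f) hy, hfg'] at key
  simp only [mul_left_comm _ (1 / (y : ℂ) ^ (1 / 2 : ℂ))] at key
  rw [integral_const_mul,
    integral_even_mul_gaussian (evenExt_neg f) (evenExt_coeFn_Ioi f) (by positivity)] at key
  linear_combination key / 2

theorem ae_eq_zero_or_le {f : HalfLineL2} {a : ℝ}
    (h : ∀ᵐ t ∂(volume.restrict (Ioo 0 a)), f t = 0) :
    ∀ᵐ t ∂(volume.restrict (Ioi (0 : ℝ))), f t = 0 ∨ a ≤ t := by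
  rw [ae_restrict_iff' measurableSet_Ioo] at h
  filter_upwards [ae_restrict_of_ae h, ae_restrict_mem measurableSet_Ioi] with t ht h0
  rcases lt_or_ge t a with h1 | h1
  · exact Or.inl (ht ⟨h0, h1⟩)
  · exact Or.inr h1

/-- Exponential decay at infinity of the theta transform of a function vanishing near zero. -/
theorem exists_norm_theta_le {f : HalfLineL2} {a : ℝ} (ha : 0 < a)
    (h : ∀ᵐ t ∂(volume.restrict (Ioo 0 a)), f t = 0) :
    ∃ C : ℝ, 0 ≤ C ∧ ∀ y : ℝ, 1 ≤ y → ‖theta f y‖ ≤ C * Real.exp (-(Real.pi * a ^ 2) * y) := by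
  -- For `t ≥ a` and `y ≥ 1`, `exp (-π y t²) ≤ exp (-π t²) exp (-π (y - 1) a²)`; the first constant
  -- comes from the `-1`.
  refine ⟨Real.exp (Real.pi * a ^ 2) *
    ∫ t in Ioi (0 : ℝ), ‖f t * Complex.exp (-Real.pi * (1 : ℝ) * t ^ 2)‖,
    mul_nonneg (Real.exp_nonneg _) (integral_nonneg fun _ => norm_nonneg _), fun y hy => ?_⟩
  refine (norm_integral_le_integral_norm _).trans ?_
  rw [mul_right_comm, ← Real.exp_add, ← integral_const_mul]
  refine integral_mono_ae (integrable_mul_gaussian f (by linarith)).norm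
    ((integrable_mul_gaussian f one_pos).norm.const_mul _) ?_
  filter_upwards [ae_eq_zero_or_le h] with t ht
  rcases ht with h0 | h1
  · simp [h0]
  · rw [norm_mul, norm_mul, norm_gaussian, norm_gaussian, mul_left_comm, ← Real.exp_add]
    refine mul_le_mul_of_nonneg_left (Real.exp_le_exp.2 ?_) (norm_nonneg _)
    have h2 : a ^ 2 ≤ t ^ 2 := by gcongr
    have h3 := mul_le_mul_of_nonneg_left h2
      (mul_nonneg Real.pi_pos.le (sub_nonneg.2 hy))
    nlinarith

/-- Two-sided decay of the theta transform of a Sonine function. -/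
theorem IsSonine.exists_norm_theta_le {f : HalfLineL2} (hf : IsSonine f) :
    ∃ C κ : ℝ, 0 ≤ C ∧ 0 < κ ∧ ∀ y : ℝ, 0 < y → ‖theta f y‖ ≤ C * Real.exp (-κ * (y + 1 / y)) := by
  obtain ⟨a, ha, hf1, hf2⟩ := hf
  obtain ⟨C₁, hC₁, h₁⟩ := Sonine.exists_norm_theta_le ha hf1
  obtain ⟨C₂, hC₂, h₂⟩ := Sonine.exists_norm_theta_le ha hf2
  set b := Real.pi * a ^ 2 with hb
  have hb0 : 0 < b := by positivity
  -- For `y ≤ 1` the factor `y ^ (-1/2) ≤ 1 / y` costs half of the rate `b`, with constant `2 / b`.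
  -- Replacing `1 / y` (or `y` when `y ≥ 1`) by `y + 1 / y` costs at most another factor `2`.
  refine ⟨C₁ + C₂ * (2 / b), b / 4, by positivity, by positivity, fun y hy => ?_⟩
  rcases le_total 1 y with h | h
  · have hy1 : 1 / y ≤ y := ((div_le_one hy).2 h).trans h
    calc ‖theta f y‖ ≤ C₁ * Real.exp (-b * y) := h₁ y h
      _ ≤ (C₁ + C₂ * (2 / b)) * Real.exp (-(b / 4) * (y + 1 / y)) := by
        have h1 : 0 ≤ C₂ * (2 / b) := by positivity
        have h2 := mul_le_mul_of_nonneg_left hy1 hb0.le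
        have h3 := mul_pos hb0 hy
        exact mul_le_mul (by linarith) (Real.exp_le_exp.2 (by linarith)) (Real.exp_nonneg _)
          (by positivity)
  · have hy1 : 1 ≤ 1 / y := (one_le_div hy).2 h
    have hth := theta_cosTransform f (y := 1 / y) (by positivity)
    rw [one_div_one_div] at hth
    have hth' : theta f y = ((1 / y : ℝ) : ℂ) ^ (1 / 2 : ℂ) * theta (cosTransform f) (1 / y) := by
      rw [hth, ← mul_assoc, mul_one_div_cancel, one_mul]
      simp [Complex.cpow_eq_zero_iff, hy.ne']
    have hsq : ‖((1 / y : ℝ) : ℂ) ^ (1 / 2 : ℂ)‖ ≤ 1 / y := by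
      rw [Complex.norm_cpow_eq_rpow_re_of_pos (by positivity)]
      refine (Real.rpow_le_rpow_of_exponent_le hy1 (z := 1) (by norm_num)).trans_eq ?_
      rw [Real.rpow_one]
    have he : 1 / y ≤ 2 / b * Real.exp (b / 2 * (1 / y)) := by
      have := Real.add_one_le_exp (b / 2 * (1 / y))
      calc 1 / y = 2 / b * (b / 2 * (1 / y)) := by field_simp
        _ ≤ _ := by gcongr; linarith
    rw [hth', norm_mul]
    calc _ ≤ (2 / b * Real.exp (b / 2 * (1 / y))) * (C₂ * Real.exp (-b * (1 / y))) :=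
          mul_le_mul (hsq.trans he) (h₂ _ hy1) (norm_nonneg _) (by positivity)
      _ = C₂ * (2 / b) * Real.exp (-(b / 2) * (1 / y)) := by
        rw [mul_mul_mul_comm, ← Real.exp_add]
        ring_nf
      _ ≤ (C₁ + C₂ * (2 / b)) * Real.exp (-(b / 4) * (y + 1 / y)) := by
        have h2 := mul_le_mul_of_nonneg_left (h.trans hy1) hb0.le
        have h3 : 0 < b * (1 / y) := by positivity
        exact mul_le_mul (by linarith) (Real.exp_le_exp.2 (by linarith)) (Real.exp_nonneg _)
          (by positivity)

theorem continuousOn_theta (f : HalfLineL2) : ContinuousOn (theta f) (Ioi 0) := by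
  intro y₀ hy₀
  have hy₀ : 0 < y₀ := hy₀
  refine ContinuousAt.continuousWithinAt ?_
  refine continuousAt_of_dominated
    (bound := fun t => ‖f t * Complex.exp (-Real.pi * (y₀ / 2 : ℝ) * t ^ 2)‖) ?_ ?_
    (integrable_mul_gaussian f (by positivity)).norm ?_
  · filter_upwards [lt_mem_nhds hy₀] with y hy
    exact (integrable_mul_gaussian f hy).1
  · filter_upwards [lt_mem_nhds (half_lt_self hy₀)] with y hy
    refine Filter.Eventually.of_forall fun t => ?_
    rw [norm_mul, norm_mul, norm_gaussian, norm_gaussian]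
    refine mul_le_mul_of_nonneg_left (Real.exp_le_exp.2 ?_) (norm_nonneg _)
    have := mul_le_mul_of_nonneg_left hy.le (mul_nonneg Real.pi_pos.le (sq_nonneg t))
    nlinarith
  · refine Filter.Eventually.of_forall fun t => ?_
    fun_prop

/-! ### Mellin transforms: continuation and growth -/

/-- Cauchy–Schwarz: away from `0`, `t ^ (-s)` is square-integrable when `Re s > 1/2`. Cutting off at
`a / 2` keeps the point `a` inside the open ray. -/
theorem integrableOn_mul_cpow {f : HalfLineL2} {a : ℝ} (ha : 0 < a)
    (h : ∀ᵐ t ∂(volume.restrict (Ioo 0 a)), f t = 0) {s : ℂ} (hs : 1 / 2 < s.re) :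
    IntegrableOn (fun t : ℝ => f t * (t : ℂ) ^ (-s)) (Ioi 0) := by
  set k : ℝ → ℂ := (Ioi (a / 2)).indicator fun t : ℝ => (t : ℂ) ^ (-s) with hk
  have hm : Measurable fun t : ℝ => (t : ℂ) ^ (-s) := by fun_prop
  have hk2 : MemLp k 2 (volume.restrict (Ioi (0 : ℝ))) := by
    rw [memLp_two_iff_integrable_sq_norm (hm.indicator measurableSet_Ioi).aestronglyMeasurable]
    have hi : IntegrableOn (fun t : ℝ => t ^ (-(2 * s.re))) (Ioi (a / 2)) :=
      integrableOn_Ioi_rpow_of_lt (by linarith) (by positivity)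
    refine ((integrable_indicator_iff measurableSet_Ioi).2 hi).restrict.congr
      (Filter.Eventually.of_forall fun t => ?_)
    by_cases ht : t ∈ Ioi (a / 2)
    · have ht0 : 0 < t := (half_pos ha).trans ht
      simp only [indicator_of_mem ht]
      rw [Complex.norm_cpow_eq_rpow_re_of_pos ht0, ← Real.rpow_natCast, ← Real.rpow_mul ht0.le]
      congr 1
      simp
      ring
    · simp [indicator_of_notMem ht]
  refine ((Lp.memLp f).integrable_mul hk2).congr ?_
  filter_upwards [ae_eq_zero_or_le h] with t ht
  rcases ht with h0 | h1
  · simp [h0]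
  · have : t ∈ Ioi (a / 2) := lt_of_lt_of_le (half_lt_self ha) h1
    simp [hk, indicator_of_mem this]

/-- The right Mellin transform has exponential growth at most in right half-planes. -/
theorem IsSonine.exists_norm_rightMellin_le {f : HalfLineL2} (hf : IsSonine f) :
    ∃ C B : ℝ, 0 ≤ C ∧ ∀ s : ℂ, 1 ≤ s.re → ‖rightMellin f s‖ ≤ C * Real.exp (B * s.re) := by
  obtain ⟨a, ha, hf1, -⟩ := hf
  have hint := integrableOn_mul_cpow ha hf1 (s := 1) (by norm_num)
  -- For `t ≥ a` and `σ = Re s ≥ 1`, `t ^ (-σ) ≤ t ^ (-1) a ^ (1 - σ)`.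
  refine ⟨Real.exp (Real.log a) * ∫ t in Ioi (0 : ℝ), ‖f t * (t : ℂ) ^ (-(1 : ℂ))‖, -Real.log a,
    mul_nonneg (Real.exp_nonneg _) (integral_nonneg fun _ => norm_nonneg _), fun s hs => ?_⟩
  refine (norm_integral_le_integral_norm _).trans ?_
  rw [mul_right_comm, ← Real.exp_add, ← integral_const_mul]
  refine integral_mono_ae (integrableOn_mul_cpow ha hf1 (by linarith)).norm
    (hint.norm.const_mul _) ?_
  filter_upwards [ae_eq_zero_or_le hf1] with t ht
  rcases ht with h0 | h1
  · simp [h0]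
  · have ht0 : 0 < t := ha.trans_le h1
    rw [norm_mul, norm_mul, mul_left_comm, Complex.norm_cpow_eq_rpow_re_of_pos ht0,
      Complex.norm_cpow_eq_rpow_re_of_pos ht0, Real.rpow_def_of_pos ht0, Real.rpow_def_of_pos ht0,
      ← Real.exp_add]
    refine mul_le_mul_of_nonneg_left (Real.exp_le_exp.2 ?_) (norm_nonneg _)
    have := mul_le_mul_of_nonneg_right (Real.log_le_log ha h1) (sub_nonneg.2 hs)
    simp
    linarith

/-- The completed Mellin transform as a Mellin transform of the theta transform. -/
noncomputable def thetaMellin (f : HalfLineL2) (s : ℂ) : ℂ := mellin (theta f) (s / 2)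

-- The decay of `theta f` beats every power at both `0` and infinity, so the strip of holomorphy of
-- its Mellin transform is the whole plane.
open Filter Asymptotics Topology in
theorem IsSonine.differentiable_thetaMellin {f : HalfLineL2} (hf : IsSonine f) :
    Differentiable ℂ (thetaMellin f) := by
  obtain ⟨C, κ, hC, hκ, hb⟩ := hf.exists_norm_theta_le
  have htop : ∀ a : ℝ, theta f =O[atTop] fun y : ℝ => y ^ (-a) := by
    intro a
    refine IsBigO.trans (g := fun y => Real.exp (-κ * y)) (IsBigO.of_bound C ?_)
      (isLittleO_exp_neg_mul_rpow_atTop hκ _).isBigO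
    filter_upwards [eventually_gt_atTop 0] with y hy
    rw [Real.norm_of_nonneg (Real.exp_nonneg _)]
    refine (hb y hy).trans (mul_le_mul_of_nonneg_left (Real.exp_le_exp.2 ?_) hC)
    have : 0 < κ * (1 / y) := by positivity
    linarith
  have hzero : ∀ b : ℝ, theta f =O[𝓝[>] 0] fun y : ℝ => y ^ (-b) := by
    intro b
    have h1 := ((isLittleO_exp_neg_mul_rpow_atTop hκ b).comp_tendsto
      tendsto_inv_nhdsGT_zero).isBigO
    have h2 : (fun y : ℝ => y⁻¹ ^ b) =ᶠ[𝓝[>] 0] fun y => y ^ (-b) := by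
      filter_upwards [self_mem_nhdsWithin] with y hy
      rw [Real.rpow_neg (mem_Ioi.1 hy).le, Real.inv_rpow (mem_Ioi.1 hy).le]
    refine IsBigO.trans (g := fun y => Real.exp (-κ * y⁻¹)) (IsBigO.of_bound C ?_)
      (h1.congr' EventuallyEq.rfl h2)
    filter_upwards [self_mem_nhdsWithin] with y hy
    rw [Real.norm_of_nonneg (Real.exp_nonneg _)]
    refine (hb y hy).trans (mul_le_mul_of_nonneg_left (Real.exp_le_exp.2 ?_) hC)
    have : 0 < κ * y := mul_pos hκ hy
    rw [one_div]
    linarith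
  intro s
  have := mellin_differentiableAt_of_isBigO_rpow (s := s / 2)
    ((continuousOn_theta f).locallyIntegrableOn measurableSet_Ioi) (htop ((s / 2).re + 1))
    (by linarith) (hzero ((s / 2).re - 1)) (by linarith)
  exact this.comp s (by fun_prop)

/-- Treats both ends of `(0, ∞)` at once, with an integer power that the exponential series can
absorb. -/
theorem rpow_le_add_inv_pow {y e : ℝ} (hy : 0 < y) {n : ℕ} (he : |e| ≤ n) :
    y ^ e ≤ (y + 1 / y) ^ n := by
  obtain ⟨h1, h2⟩ := abs_le.1 he
  have hy' : 0 < 1 / y := by positivity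
  rcases le_total 1 y with h | h
  · calc y ^ e ≤ y ^ (n : ℝ) := Real.rpow_le_rpow_of_exponent_le h h2
      _ = y ^ n := Real.rpow_natCast _ _
      _ ≤ _ := by gcongr; linarith
  · calc y ^ e ≤ y ^ (-n : ℝ) := Real.rpow_le_rpow_of_exponent_ge hy h h1
      _ = (1 / y) ^ n := by rw [Real.rpow_neg hy.le, Real.rpow_natCast, one_div, inv_pow]
      _ ≤ _ := by gcongr; linarith

/-- Uses `n! ≤ n ^ n` and `log (2 X) ≤ 4 X ^ (1/2)`. The crude exponent `3/2` suffices, as only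
growth of order below `2` is needed. -/
theorem factorial_mul_pow_le {B : ℝ} (hB : 0 ≤ B) {X : ℝ} (hX : 1 ≤ X) {n : ℕ} (hn : n ≤ 2 * X) :
    n.factorial * B ^ n ≤ Real.exp ((8 + 2 * Real.log (1 + B)) * X ^ (3 / 2 : ℝ)) := by
  have hX0 : 0 < X := by linarith
  have hXX : X ≤ X ^ (3 / 2 : ℝ) := by
    simpa using Real.rpow_le_rpow_of_exponent_le hX (show (1 : ℝ) ≤ 3 / 2 by norm_num)
  have hL : 0 ≤ Real.log (1 + B) := Real.log_nonneg (by linarith)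
  have h1 : B ^ n ≤ Real.exp (2 * Real.log (1 + B) * X ^ (3 / 2 : ℝ)) := by
    calc B ^ n ≤ (1 + B) ^ n := by gcongr; linarith
      _ = Real.exp (n * Real.log (1 + B)) := by
        rw [Real.exp_nat_mul, Real.exp_log (by linarith)]
      _ ≤ _ := by
        refine Real.exp_le_exp.2 ?_
        calc n * Real.log (1 + B) ≤ (2 * X ^ (3 / 2 : ℝ)) * Real.log (1 + B) :=
              mul_le_mul_of_nonneg_right (by linarith) hL
          _ = _ := by ring
  have h2 : (n.factorial : ℝ) ≤ Real.exp (8 * X ^ (3 / 2 : ℝ)) := by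
    have hlog : Real.log (2 * X) ≤ 4 * X ^ (1 / 2 : ℝ) := by
      refine (Real.log_le_rpow_div (by linarith) (show (0 : ℝ) < 1 / 2 by norm_num)).trans ?_
      rw [Real.mul_rpow (by norm_num) hX0.le]
      have : (2 : ℝ) ^ (1 / 2 : ℝ) ≤ 2 := by
        simpa using Real.rpow_le_rpow_of_exponent_le (show (1 : ℝ) ≤ 2 by norm_num)
          (show (1 / 2 : ℝ) ≤ 1 by norm_num)
      have := mul_le_mul_of_nonneg_right this (Real.rpow_nonneg hX0.le (1 / 2))
      linarith
    calc (n.factorial : ℝ) ≤ (n : ℝ) ^ n := by exact_mod_cast Nat.factorial_le_pow n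
      _ ≤ (2 * X) ^ n := by gcongr
      _ = Real.exp (n * Real.log (2 * X)) := by
        rw [Real.exp_nat_mul, Real.exp_log (by linarith)]
      _ ≤ _ := by
        refine Real.exp_le_exp.2 ?_
        calc n * Real.log (2 * X) ≤ (2 * X) * (4 * X ^ (1 / 2 : ℝ)) :=
              mul_le_mul hn hlog (Real.log_nonneg (by linarith)) (by linarith)
          _ = 8 * X ^ (3 / 2 : ℝ) := by
            rw [show (3 / 2 : ℝ) = 1 + 1 / 2 by norm_num, Real.rpow_add hX0, Real.rpow_one]
            ring
  calc _ ≤ _ := mul_le_mul h2 h1 (by positivity) (Real.exp_nonneg _)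
    _ = _ := by rw [← Real.exp_add]; ring_nf

/-- The completed Mellin transform of a Sonine function has growth of order less than two. -/
theorem IsSonine.exists_norm_thetaMellin_le {f : HalfLineL2} (hf : IsSonine f) :
    ∃ A : ℝ, 0 ≤ A ∧ ∀ s, ‖thetaMellin f s‖ ≤ Real.exp (A * (1 + ‖s‖) ^ (3 / 2 : ℝ)) := by
  obtain ⟨C, κ, hC, hκ, hb⟩ := hf.exists_norm_theta_le
  have hL : 0 ≤ Real.log (1 + 2 / κ) := Real.log_nonneg (by
    have : 0 < 2 / κ := by positivity
    linarith)
  refine ⟨C * (2 / κ) + (8 + 2 * Real.log (1 + 2 / κ)), by positivity, fun s => ?_⟩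
  set n : ℕ := ⌈‖s‖ + 1⌉₊ with hn
  have hn1 : ‖s‖ + 1 ≤ n := Nat.le_ceil _
  have hn2 : (n : ℝ) ≤ 2 * (1 + ‖s‖) := by
    have := Nat.ceil_lt_add_one (show 0 ≤ ‖s‖ + 1 by positivity)
    have := norm_nonneg s
    linarith
  have hint : IntegrableOn (fun y : ℝ => Real.exp (-(κ / 2) * y)) (Ioi 0) := by
    have := exp_neg_integrableOn_Ioi 0 (half_pos hκ)
    simpa using this
  have hpt : ∀ y ∈ Ioi (0 : ℝ), ‖(y : ℂ) ^ (s / 2 - 1) • theta f y‖ ≤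
      C * (n.factorial * (2 / κ) ^ n) * Real.exp (-(κ / 2) * y) := by
    intro y hy
    have hy : 0 < y := hy
    set w := y + 1 / y with hw
    have hw0 : 0 < w := by positivity
    have hyw : y ≤ w := by
      have : 0 < 1 / y := by positivity
      linarith
    rw [norm_smul, Complex.norm_cpow_eq_rpow_re_of_pos hy]
    have he : |(s / 2 - 1).re| ≤ n := by
      refine (Complex.abs_re_le_norm _).trans (le_trans ?_ hn1)
      refine (norm_sub_le _ _).trans ?_
      have := norm_nonneg s
      rw [norm_div, norm_one, RCLike.norm_ofNat]
      linarith
    -- Half of the decay rate `κ` pays for `w ^ n`, at the price `n! (2 / κ) ^ n`; the other half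
    -- keeps the integral convergent.
    have hp := Real.pow_div_factorial_le_exp (κ / 2 * w) (by positivity) n
    have hp' : w ^ n ≤ n.factorial * (2 / κ) ^ n * Real.exp (κ / 2 * w) := by
      rw [div_le_iff₀ (by positivity), mul_pow] at hp
      calc w ^ n = (2 / κ) ^ n * ((κ / 2) ^ n * w ^ n) := by
            rw [← mul_assoc, ← mul_pow]
            field_simp
            simp
        _ ≤ (2 / κ) ^ n * (Real.exp (κ / 2 * w) * n.factorial) := by gcongr
        _ = _ := by ring
    calc _ ≤ (n.factorial * (2 / κ) ^ n * Real.exp (κ / 2 * w)) * (C * Real.exp (-κ * w)) :=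
          mul_le_mul ((rpow_le_add_inv_pow hy he).trans hp') (hb y hy) (norm_nonneg _)
            (by positivity)
      _ = C * (n.factorial * (2 / κ) ^ n) * Real.exp (-(κ / 2) * w) := by
        rw [mul_mul_mul_comm, ← Real.exp_add]
        ring_nf
      _ ≤ _ := by
        refine mul_le_mul_of_nonneg_left (Real.exp_le_exp.2 ?_) (by positivity)
        nlinarith
  have hX : (1 : ℝ) ≤ 1 + ‖s‖ := by have := norm_nonneg s; linarith
  have hX1 : 1 ≤ (1 + ‖s‖) ^ (3 / 2 : ℝ) := Real.one_le_rpow hX (by norm_num)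
  calc ‖thetaMellin f s‖
      ≤ ∫ y in Ioi (0 : ℝ), C * (n.factorial * (2 / κ) ^ n) * Real.exp (-(κ / 2) * y) := by
        refine norm_integral_le_of_norm_le (hint.const_mul _) ?_
        filter_upwards [ae_restrict_mem measurableSet_Ioi] with y hy using hpt y hy
    _ = (C * (2 / κ)) * (n.factorial * (2 / κ) ^ n) := by
        rw [integral_const_mul, integral_exp_mul_Ioi (by linarith)]
        simp
        ring
    _ ≤ Real.exp (C * (2 / κ) * (1 + ‖s‖) ^ (3 / 2 : ℝ)) *
        Real.exp ((8 + 2 * Real.log (1 + 2 / κ)) * (1 + ‖s‖) ^ (3 / 2 : ℝ)) := by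
        refine mul_le_mul ?_ (factorial_mul_pow_le (by positivity) hX hn2) (by positivity)
          (Real.exp_nonneg _)
        have h0 : 0 ≤ C * (2 / κ) := by positivity
        have := Real.add_one_le_exp (C * (2 / κ) * (1 + ‖s‖) ^ (3 / 2 : ℝ))
        have := mul_le_mul_of_nonneg_left hX1 h0
        linarith
    _ = _ := by rw [← Real.exp_add]; ring_nf

theorem integral_cpow_mul_gaussian {s : ℂ} (hs : 0 < s.re) {t : ℝ} (ht : 0 < t) :
    ∫ y in Ioi (0 : ℝ), (y : ℂ) ^ (s / 2 - 1) * Complex.exp (-Real.pi * y * t ^ 2) =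
      (Real.pi : ℂ) ^ (-s / 2) * Complex.Gamma (s / 2) * (t : ℂ) ^ (-s) := by
  have hr : 0 < Real.pi * t ^ 2 := by positivity
  have h := Complex.integral_cpow_mul_exp_neg_mul_Ioi (a := s / 2) (r := (Real.pi * t ^ 2 : ℝ))
    (by simpa using hs) (by simpa using hr)
  have e1 : ∀ y : ℝ, Complex.exp (-Real.pi * y * t ^ 2) =
      Complex.exp (-((Real.pi * t ^ 2 : ℝ) * y)) := fun y => by
    push_cast
    ring_nf
  simp only [e1]
  rw [h]
  have e2 : (1 / ((Real.pi * t ^ 2 : ℝ) : ℂ)) ^ (s / 2) =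
      (Real.pi : ℂ) ^ (-s / 2) * (t : ℂ) ^ (-s) := by
    have ht0 : (t : ℂ) ≠ 0 := Complex.ofReal_ne_zero.2 ht.ne'
    rw [one_div, Complex.inv_cpow_ofReal_nonneg hr.le, Complex.ofReal_mul,
      Complex.mul_cpow_ofReal_nonneg Real.pi_pos.le (by positivity), sq, Complex.ofReal_mul,
      Complex.mul_cpow_ofReal_nonneg ht.le ht.le, ← Complex.cpow_add _ _ ht0, add_halves, neg_div,
      Complex.cpow_neg, Complex.cpow_neg, mul_inv]
  rw [e2]
  ring

/-- Fubini: integrating the Gaussian in `y` first yields the Gamma factor times `t ^ (-s)`. The same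
computation with absolute values reduces integrability to that of `f t * t ^ (-s)`. -/
theorem IsSonine.isEntireContinuation {f : HalfLineL2} (hf : IsSonine f) :
    IsEntireContinuation f (thetaMellin f) := by
  refine ⟨hf.differentiable_thetaMellin, fun s hs => ?_⟩
  obtain ⟨a, ha, hf1, -⟩ := hf
  have hs0 : 0 < s.re := by linarith
  set μ := volume.restrict (Ioi (0 : ℝ)) with hμ
  have hmeas : AEStronglyMeasurable (fun p : ℝ × ℝ => (p.1 : ℂ) ^ (s / 2 - 1) *
      (f p.2 * Complex.exp (-Real.pi * p.1 * p.2 ^ 2))) (μ.prod μ) := by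
    have h1 : AEStronglyMeasurable (fun p : ℝ × ℝ => f p.2) (μ.prod μ) :=
      (Lp.aestronglyMeasurable f).comp_snd
    have h2 : Measurable fun p : ℝ × ℝ => (p.1 : ℂ) ^ (s / 2 - 1) := by fun_prop
    have h3 : Measurable fun p : ℝ × ℝ => Complex.exp (-Real.pi * p.1 * p.2 ^ 2) := by fun_prop
    exact h2.aestronglyMeasurable.mul (h1.mul h3.aestronglyMeasurable)
  have hy : ∀ t : ℝ, 0 < t → IntegrableOn (fun y : ℝ => y ^ (s.re / 2 - 1) *
      Real.exp (-(Real.pi * t ^ 2) * y)) (Ioi 0) := fun t ht => by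
    have := integrableOn_rpow_mul_exp_neg_mul_rpow (p := 1) (s := s.re / 2 - 1)
      (b := Real.pi * t ^ 2) (by linarith) one_pos (by positivity)
    simpa using this
  have hnorm : ∀ y t : ℝ, 0 < y → ‖(y : ℂ) ^ (s / 2 - 1) *
      (f t * Complex.exp (-Real.pi * y * t ^ 2))‖ =
      ‖f t‖ * (y ^ (s.re / 2 - 1) * Real.exp (-(Real.pi * t ^ 2) * y)) := fun y t hy => by
    rw [norm_mul, norm_mul, norm_gaussian, Complex.norm_cpow_eq_rpow_re_of_pos hy]
    have : (s / 2 - 1).re = s.re / 2 - 1 := by simp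
    rw [this, show -Real.pi * y * t ^ 2 = -(Real.pi * t ^ 2) * y by ring]
    ring
  have hint : Integrable (fun p : ℝ × ℝ => (p.1 : ℂ) ^ (s / 2 - 1) *
      (f p.2 * Complex.exp (-Real.pi * p.1 * p.2 ^ 2))) (μ.prod μ) := by
    rw [integrable_prod_iff' hmeas]
    constructor
    · filter_upwards [ae_restrict_mem measurableSet_Ioi] with t ht
      refine ((hy t ht).const_mul ‖f t‖).mono' (Measurable.aestronglyMeasurable (by fun_prop)) ?_
      filter_upwards [ae_restrict_mem measurableSet_Ioi] with y hy
      exact (hnorm y t hy).le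
    · have h1 := (integrableOn_mul_cpow ha hf1 hs).norm.const_mul
        (Real.pi ^ (-(s.re / 2)) * Real.Gamma (s.re / 2))
      refine h1.congr ?_
      filter_upwards [ae_restrict_mem measurableSet_Ioi] with t ht
      have ht : 0 < t := ht
      rw [setIntegral_congr_fun measurableSet_Ioi fun y hy => hnorm y t hy, integral_const_mul]
      have h2 := Real.integral_rpow_mul_exp_neg_mul_Ioi (a := s.re / 2) (r := Real.pi * t ^ 2)
        (by positivity) (by positivity)
      simp only [← neg_mul (Real.pi * t ^ 2)] at h2
      rw [h2, norm_mul, Complex.norm_cpow_eq_rpow_re_of_pos ht, one_div, Real.inv_rpow (by positivity),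
        Real.mul_rpow Real.pi_pos.le (by positivity), ← Real.rpow_natCast t 2,
        ← Real.rpow_mul ht.le, Real.rpow_neg Real.pi_pos.le, Complex.neg_re, Real.rpow_neg ht.le,
        show ((2 : ℕ) : ℝ) * (s.re / 2) = s.re by push_cast; ring, mul_inv]
      ring
  calc thetaMellin f s
      = ∫ y, ∫ t, (y : ℂ) ^ (s / 2 - 1) * (f t * Complex.exp (-Real.pi * y * t ^ 2)) ∂μ ∂μ := by
        simp only [integral_const_mul]
        rfl
    _ = ∫ t, ∫ y, (y : ℂ) ^ (s / 2 - 1) * (f t * Complex.exp (-Real.pi * y * t ^ 2)) ∂μ ∂μ :=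
        integral_integral_swap hint
    _ = ∫ t, (Real.pi : ℂ) ^ (-s / 2) * Complex.Gamma (s / 2) * (f t * (t : ℂ) ^ (-s)) ∂μ := by
        refine integral_congr_ae ?_
        filter_upwards [ae_restrict_mem measurableSet_Ioi] with t ht
        simp only [mul_left_comm _ (f t)]
        rw [integral_const_mul, integral_cpow_mul_gaussian hs0 ht]
    _ = _ := by rw [integral_const_mul]; rfl

theorem IsSonine.completedMellin_eq {f : HalfLineL2} (hf : IsSonine f) :
    completedMellin f = thetaMellin f := by
  have h : ∃ E : ℂ → ℂ, IsEntireContinuation f E := ⟨_, hf.isEntireContinuation⟩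
  rw [completedMellin, dif_pos h]
  exact h.choose_spec.unique hf.isEntireContinuation

theorem gammaFactor_ne_zero {s : ℂ} (hs : 0 < s.re) :
    (Real.pi : ℂ) ^ (-s / 2) * Complex.Gamma (s / 2) ≠ 0 := by
  refine mul_ne_zero ?_ (Complex.Gamma_ne_zero_of_re_pos (by simpa using hs))
  simp [Complex.cpow_eq_zero_iff, Real.pi_ne_zero]

/-- The transform is the quotient of an entire function by the zero-free Gamma factor, so no
differentiation under the integral is needed. -/
theorem IsSonine.differentiableAt_rightMellin {f : HalfLineL2} (hf : IsSonine f) {s : ℂ}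
    (hs : 1 / 2 < s.re) : DifferentiableAt ℂ (rightMellin f) s := by
  have ho : IsOpen {s : ℂ | 1 / 2 < s.re} := isOpen_lt continuous_const Complex.continuous_re
  have hpi : (Real.pi : ℂ) ≠ 0 := Complex.ofReal_ne_zero.2 Real.pi_ne_zero
  have hG : DifferentiableAt ℂ (fun s : ℂ => (Real.pi : ℂ) ^ (-s / 2) * Complex.Gamma (s / 2)) s := by
    refine DifferentiableAt.fun_mul ?_ ?_
    · exact DifferentiableAt.const_cpow (by fun_prop) (Or.inl hpi)
    · refine DifferentiableAt.comp (g := Complex.Gamma) s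
        (Complex.differentiableAt_Gamma _ fun m hm => ?_) (by fun_prop)
      have := congrArg Complex.re hm
      simp at this
      have h2 : (0 : ℝ) ≤ m := Nat.cast_nonneg m
      linarith
  refine ((hf.differentiable_thetaMellin s).div hG
    (gammaFactor_ne_zero (by linarith))).congr_of_eventuallyEq ?_
  filter_upwards [ho.mem_nhds hs] with z hz
  have hz : 1 / 2 < z.re := hz
  simp only [Pi.div_apply]
  rw [hf.isEntireContinuation.2 z hz, mul_div_cancel_left₀ _ (gammaFactor_ne_zero (by linarith))]

theorem rightMellin_eq_mellin (f : HalfLineL2) (s : ℂ) : rightMellin f s = mellin f (1 - s) := by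
  rw [rightMellin, mellin]
  refine integral_congr_ae (Filter.Eventually.of_forall fun t => ?_)
  simp only [smul_eq_mul, sub_sub_cancel_left, mul_comm]

theorem IsSonine.mellinConvergent {f : HalfLineL2} (hf : IsSonine f) {s : ℂ}
    (hs : 1 / 2 < s.re) : MellinConvergent f (1 - s) := by
  obtain ⟨a, ha, hf1, -⟩ := hf
  refine (integrableOn_mul_cpow ha hf1 hs).congr (Filter.Eventually.of_forall fun t => ?_)
  simp only [smul_eq_mul, sub_sub_cancel_left, mul_comm]

/-- The line `Re s = 1` corresponds to the abscissa `0` of the ordinary Mellin transform, where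
injectivity applies. -/
theorem IsSonine.eq_zero_of_thetaMellin_eq_zero {f : HalfLineL2} (hf : IsSonine f)
    (h : thetaMellin f = 0) : f = 0 := by
  refine Lp.eq_zero_iff_ae_eq_zero.2 (ae_eq_zero_of_mellin_eq_zero ?_ fun y => ?_)
  · simpa using hf.mellinConvergent (s := 1) (by norm_num)
  · have h1 := hf.isEntireContinuation.2 (1 - y * Complex.I) (by simp; norm_num)
    rw [h, Pi.zero_apply, eq_comm, mul_eq_zero] at h1
    have h2 := h1.resolve_left (gammaFactor_ne_zero (by simp))
    rwa [rightMellin_eq_mellin, sub_sub_cancel] at h2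

/-! ### Comparing two Sonine functions -/

open Complex in
/-- A relation `f̂(s) = exp (α s + β) ĝ(s)` between right Mellin transforms forces `α` to be real. -/
theorem IsSonine.im_eq_zero {f g : HalfLineL2} (hf : IsSonine f) (hg : IsSonine g) (hf0 : f ≠ 0)
    {α β : ℂ} (h : ∀ s : ℂ, 1 / 2 < s.re → rightMellin f s = exp (α * s + β) * rightMellin g s) :
    α.im = 0 := by
  by_contra hα
  obtain ⟨C₁, B₁, hC₁, h₁⟩ := hf.exists_norm_rightMellin_le
  obtain ⟨C₂, B₂, hC₂, h₂⟩ := hg.exists_norm_rightMellin_le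
  -- The growth of `f̂` and that of `ĝ` give two bounds for `f̂`, differing by `exp (-Im α Im s)`.
  -- The twist by `Im α / 2` in `H` balances them, so that one or the other yields the decay `exp
  -- (-|Im α| |Im z| / 2)`. The shift by `1` puts `Re z ≥ 0` into the region `Re s ≥ 1` of the
  -- bounds.
  set B := max B₁ (B₂ + α.re) with hB
  set C := max C₁ (Real.exp β.re * C₂) with hC
  set H : ℂ → ℂ := fun z => rightMellin f (z + 1) * exp (-(B + (α.im / 2 : ℝ) * I) * (z + 1)) with hH
  have hC0 : 0 ≤ C := hC₁.trans (le_max_left _ _)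
  have hd : ∀ z : ℂ, 0 ≤ z.re → DifferentiableAt ℂ H z := fun z hz => by
    have h3 : DifferentiableAt ℂ (fun z => rightMellin f (z + 1)) z :=
      DifferentiableAt.comp (g := rightMellin f) z
        (hf.differentiableAt_rightMellin (by simp; linarith)) (by fun_prop)
    exact h3.mul (by fun_prop)
  have hclos : closure {z : ℂ | 0 < z.re} ⊆ {z : ℂ | 0 ≤ z.re} :=
    closure_minimal (fun z (hz : 0 < z.re) => hz.le) (isClosed_le continuous_const continuous_re)
  have hdc : DiffContOnCl ℂ H {z | 0 < z.re} :=
    ⟨fun z hz => (hd z (le_of_lt hz)).differentiableWithinAt,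
      fun z hz => (hd z (hclos hz)).continuousAt.continuousWithinAt⟩
  have hzero := eq_zero_of_exp_decay (G := H) (C := C) (c := |α.im| / 2) (by positivity) hdc
    fun z hz => ?_
  · refine hf0 (hf.eq_zero_of_thetaMellin_eq_zero ?_)
    have ho : IsOpen {s : ℂ | 1 < s.re} := isOpen_lt continuous_const continuous_re
    refine AnalyticOnNhd.eq_of_eventuallyEq (z₀ := 2)
      (fun z _ => hf.differentiable_thetaMellin.analyticAt z) (fun z _ => analyticAt_const) ?_
    filter_upwards [ho.mem_nhds (by norm_num : (2 : ℂ) ∈ {s : ℂ | 1 < s.re})] with s hs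
    have hs : 1 < s.re := hs
    have h3 := hzero (s - 1) (by simpa using hs)
    simp only [hH, sub_add_cancel, mul_eq_zero, exp_ne_zero, or_false] at h3
    rw [hf.isEntireContinuation.2 s (by linarith), h3, mul_zero]
    rfl
  · have hre : (z + 1).re = z.re + 1 := by simp
    have him : (z + 1).im = z.im := by simp
    have hz1 : 1 ≤ (z + 1).re := by rw [hre]; linarith
    have b₁ : ‖rightMellin f (z + 1)‖ ≤ C * Real.exp (B * (z + 1).re) :=
      (h₁ _ hz1).trans (mul_le_mul (le_max_left _ _) (Real.exp_le_exp.2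
        (mul_le_mul_of_nonneg_right (le_max_left _ _) (by linarith))) (Real.exp_nonneg _) hC0)
    have b₂ : ‖rightMellin f (z + 1)‖ ≤ C * Real.exp (B * (z + 1).re - α.im * z.im) := by
      rw [h _ (by linarith), norm_mul, norm_exp]
      have e1 : (α * (z + 1) + β).re = α.re * (z + 1).re - α.im * z.im + β.re := by
        rw [add_re, mul_re, him]
      calc _ ≤ Real.exp (α * (z + 1) + β).re * (C₂ * Real.exp (B₂ * (z + 1).re)) :=
            mul_le_mul_of_nonneg_left (h₂ _ hz1) (Real.exp_nonneg _)
        _ = (Real.exp β.re * C₂) * Real.exp ((B₂ + α.re) * (z + 1).re - α.im * z.im) := by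
            rw [e1, mul_left_comm, ← Real.exp_add, mul_right_comm, ← Real.exp_add, mul_comm]
            ring_nf
        _ ≤ _ := by
            refine mul_le_mul (le_max_right _ _) (Real.exp_le_exp.2 ?_) (Real.exp_nonneg _) hC0
            have := mul_le_mul_of_nonneg_right (le_max_right B₁ (B₂ + α.re))
              (show 0 ≤ (z + 1).re by linarith)
            linarith
    have e2 : ‖H z‖ = ‖rightMellin f (z + 1)‖ *
        Real.exp (-B * (z + 1).re + α.im / 2 * z.im) := by
      rw [hH, norm_mul, norm_exp, mul_re, him]
      congr 2
      simp
    rw [e2]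
    have e3 : |α.im| * |z.im| = |α.im * z.im| := (abs_mul _ _).symm
    rcases le_total 0 (α.im * z.im) with hs | hs
    · rw [abs_of_nonneg hs] at e3
      calc _ ≤ _ := mul_le_mul_of_nonneg_right b₂ (Real.exp_nonneg _)
        _ = _ := by
          rw [mul_assoc, ← Real.exp_add]
          congr 2
          linear_combination e3 / 2
    · rw [abs_of_nonpos hs] at e3
      calc _ ≤ _ := mul_le_mul_of_nonneg_right b₁ (Real.exp_nonneg _)
        _ = _ := by
          rw [mul_assoc, ← Real.exp_add]
          congr 2
          linear_combination e3 / 2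

/-- A relation `f̂(s) = exp (a s + β) ĝ(s)` with `a` real identifies `f` as a multiplicative
translate of `g`. -/
theorem IsSonine.ae_eq_of_rightMellin_eq {f g : HalfLineL2} (hf : IsSonine f) (hg : IsSonine g)
    {a : ℝ} {β : ℂ}
    (h : ∀ s : ℂ, 1 / 2 < s.re → rightMellin f s = Complex.exp (a * s + β) * rightMellin g s) :
    ∀ᵐ t ∂(volume.restrict (Ioi (0 : ℝ))), f t = Complex.exp (a + β) * g (Real.exp a * t) := by
  -- Dilation by `r` multiplies the transform by `r ^ (s - 1) = exp (a s - a)`; the extra `a` in `c`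
  -- cancels the `-a`.
  set c := Complex.exp (a + β) with hc
  set r := Real.exp a with hr
  have hr0 : 0 < r := Real.exp_pos _
  have hgr : ∀ s : ℂ, 1 / 2 < s.re → HasMellin (fun t => c • g (r * t)) (1 - s)
      (rightMellin f s) := by
    intro s hs
    have h1 := hasMellin_const_smul ((MellinConvergent.comp_mul_left hr0).2
      (hg.mellinConvergent hs)) c
    rw [mellin_comp_mul_left _ _ hr0, ← rightMellin_eq_mellin] at h1
    convert h1 using 1
    rw [h s hs, smul_eq_mul, smul_eq_mul, ← mul_assoc, hc, hr, Complex.ofReal_exp,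
      Complex.cpow_def_of_ne_zero (Complex.exp_ne_zero _), ← Complex.ofReal_exp,
      ← Complex.ofReal_log (Real.exp_pos _).le, Real.log_exp, ← Complex.exp_add]
    ring_nf
  have hsub : ∀ s : ℂ, 1 / 2 < s.re → HasMellin (fun t => f t - c • g (r * t)) (1 - s) 0 := by
    intro s hs
    have := hasMellin_sub (hf.mellinConvergent hs) (hgr s hs).1
    rwa [(hgr s hs).2, ← rightMellin_eq_mellin, sub_self] at this
  have h0 := ae_eq_zero_of_mellin_eq_zero (f := fun t => f t - c • g (r * t))
    (by simpa using (hsub 1 (by norm_num)).1) fun y => by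
      have := (hsub (1 - y * Complex.I) (by simp; norm_num)).2
      rwa [sub_sub_cancel] at this
  filter_upwards [h0] with t ht
  simpa [sub_eq_zero] using ht

end Sonine

theorem mainTheorem11 (f g : Sonine.HalfLineL2) (hf : Sonine.IsSonine f) (hg : Sonine.IsSonine g)
    (hf0 : f ≠ 0) (hg0 : g ≠ 0) (hZ : Sonine.zeroMultiset f = Sonine.zeroMultiset g) :
    ∃ c : ℂ, c ≠ 0 ∧ ∃ r : ℝ, 0 < r ∧
      ∀ᵐ t ∂(volume.restrict (Ioi (0 : ℝ))), f t = c * g (r * t) := by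
  obtain ⟨A₁, hA₁, h₁⟩ := hf.exists_norm_thetaMellin_le
  obtain ⟨A₂, hA₂, h₂⟩ := hg.exists_norm_thetaMellin_le
  have hord : ∀ z, analyticOrderAt (Sonine.thetaMellin f) z =
      analyticOrderAt (Sonine.thetaMellin g) z := fun z => by
    have := congrFun hZ z
    rwa [Sonine.zeroMultiset, Sonine.zeroMultiset, hf.completedMellin_eq,
      hg.completedMellin_eq] at this
  -- The sum `A₁ + A₂` serves as a common growth constant for both functions.
  obtain ⟨α, β, hαβ⟩ := Sonine.exists_eq_exp_mul hf.differentiable_thetaMellin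
    hg.differentiable_thetaMellin (fun h => hf0 (hf.eq_zero_of_thetaMellin_eq_zero h)) hord
    (A := A₁ + A₂) (by positivity)
    (fun z => (h₁ z).trans (Real.exp_le_exp.2
      (mul_le_mul_of_nonneg_right (by linarith) (by positivity))))
    (fun z => (h₂ z).trans (Real.exp_le_exp.2
      (mul_le_mul_of_nonneg_right (by linarith) (by positivity))))
  have hrel : ∀ s : ℂ, 1 / 2 < s.re →
      Sonine.rightMellin f s = Complex.exp (α * s + β) * Sonine.rightMellin g s := fun s hs => by
    have := hαβ s
    rw [hf.isEntireContinuation.2 s hs, hg.isEntireContinuation.2 s hs, mul_left_comm] at this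
    exact mul_left_cancel₀ (Sonine.gammaFactor_ne_zero (by linarith)) this
  have hα : (α.re : ℂ) = α := Complex.ext rfl (hf.im_eq_zero hg hf0 hrel).symm
  exact ⟨Complex.exp (α.re + β), Complex.exp_ne_zero _, Real.exp α.re, Real.exp_pos _,
    hf.ae_eq_of_rightMellin_eq hg (by simpa only [hα] using hrel)⟩
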